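/- Consider a ring of $N$ spins $1/2$ (sites $i \in \mathbb{Z}/N\mathbb{Z}$, so that site $N+1$ is site $1$), with Pauli matrices $X_i, Y_i, Z_i$ at site $i$, and the Hamiltonian $$H = \sum_{i=1}^N \left( J_X X_i X_{i+1} + J_Y Y_i Y_{i+1} + J_Z Z_i Z_{i+1} + h_X X_i + h_Y Y_i + h_Z Z_i \right)$$ with real coefficients and $J_X, J_Y, J_Z \neq 0$. An operator on the chain is called an $l$-support operator if it acts on $l$ consecutive sites. It is called a $k$-support quantity if it is a sum of $l$-support operators with $l \le k$ but not a sum of $l$-support operators with $l \le k-1$. A $k$-support conserved quantity is a $k$-support quantity that commutes with $H$. Let $3 \le k \le N/2$. (1) If $J_X \neq J_Y$ and $h_Z \neq 0$, then $H$ has no $k$-support conserved quantity. (2) More generally, $H$ has no $k$-support conserved quantity except possibly in the following integrable cases: $J_X = J_Y = J_Z$ (the XXX model, with any field); $J_X = J_Y$ and $h_X = h_Y = 0$, or $J_Y = J_Z$ and $h_Y = h_Z = 0$, or $J_Z = J_X$ and $h_Z = h_X = 0$ (the XXZ model with a field along its axis); $h_X = h_Y = h_Z = 0$ (the XYZ model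 without field). -/

import Mathlib

/-- A spin configuration of `N` spins 1/2 on a ring; the sites are labelled by `ZMod N`, so that
site `N + 1` is site `1`. -/
abbrev SpinConfig (N : ℕ) : Type := ZMod N → Fin 2

/-- Operators on the Hilbert space `(ℂ²)^{⊗ N}`, as matrices in the product basis. -/
abbrev ChainOp (N : ℕ) : Type := Matrix (SpinConfig N) (SpinConfig N) ℂ

/-- The Pauli matrix `X`. -/
def pauliX : Matrix (Fin 2) (Fin 2) ℂ := !![0, 1; 1, 0]

/-- The Pauli matrix `Y`. -/
def pauliY : Matrix (Fin 2) (Fin 2) ℂ := !![0, -Complex.I; Complex.I, 0]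

/-- The Pauli matrix `Z`. -/
def pauliZ : Matrix (Fin 2) (Fin 2) ℂ := !![1, 0; 0, -1]

/-- `A` acts on the set of sites `S`: in the tensor factorization of the Hilbert space into the
spins in `S` and the spins outside `S`, it is `B ⊗ 1` for some operator `B` on the spins in `S`. -/
def ActsOn {N : ℕ} [NeZero N] (S : Finset (ZMod N)) (A : ChainOp N) : Prop :=
  ∃ B : Matrix (S → Fin 2) (S → Fin 2) ℂ, ∀ s t : SpinConfig N,
    A s t = if ∀ j, j ∉ S → s j = t j then B (fun j => s j) (fun j => t j) else 0

/-- The one-spin operator `σ` placed at site `i`, with the identity at all other sites. -/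
def siteOp {N : ℕ} [NeZero N] (σ : Matrix (Fin 2) (Fin 2) ℂ) (i : ZMod N) : ChainOp N :=
  fun s t => if ∀ j, j ≠ i → s j = t j then σ (s i) (t i) else 0

/-- The Hamiltonian in standard form on the ring of `N` sites,
`∑ i, (JX Xᵢ Xᵢ₊₁ + JY Yᵢ Yᵢ₊₁ + JZ Zᵢ Zᵢ₊₁ + hX Xᵢ + hY Yᵢ + hZ Zᵢ)`. -/
noncomputable def standardHamiltonian (N : ℕ) [NeZero N] (JX JY JZ hX hY hZ : ℝ) : ChainOp N :=
  ∑ i : ZMod N,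
    ((JX : ℂ) • (siteOp pauliX i * siteOp pauliX (i + 1))
      + (JY : ℂ) • (siteOp pauliY i * siteOp pauliY (i + 1))
      + (JZ : ℂ) • (siteOp pauliZ i * siteOp pauliZ (i + 1))
      + (hX : ℂ) • siteOp pauliX i
      + (hY : ℂ) • siteOp pauliY i
      + (hZ : ℂ) • siteOp pauliZ i)

/-- The `l` consecutive sites `i, i + 1, …, i + l - 1`. -/
def siteWindow {N : ℕ} (i : ZMod N) (l : ℕ) : Finset (ZMod N) :=
  (Finset.range l).image (fun m : ℕ => i + (m : ZMod N))

/-- `A` is an `l`-support operator: it acts on `l` consecutive sites. -/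
def IsSupportOperator {N : ℕ} [NeZero N] (l : ℕ) (A : ChainOp N) : Prop :=
  ∃ i : ZMod N, ActsOn (siteWindow i l) A

/-- `Q` is a `k`-support quantity: it is a sum of `l`-support operators with `l ≤ k`, but not a sum
of `l`-support operators with `l ≤ k - 1`. (Scalar multiples of `l`-support operators are
`l`-support operators, so linear combinations and sums are the same here.) -/
def IsSupportQuantity {N : ℕ} [NeZero N] (k : ℕ) (Q : ChainOp N) : Prop :=
  Q ∈ Submodule.span ℂ {A : ChainOp N | ∃ l, l ≤ k ∧ IsSupportOperator l A} ∧
  Q ∉ Submodule.span ℂ {A : ChainOp N | ∃ l, l < k ∧ IsSupportOperator l A}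

/-- `Q` is a `k`-support conserved quantity of the Hamiltonian `H`. -/
def IsSupportConservedQuantity {N : ℕ} [NeZero N] (H : ChainOp N) (k : ℕ) (Q : ChainOp N) : Prop :=
  Commute Q H ∧ IsSupportQuantity k Q

/-! Pairing with a conserved `Q` by the trace gives a functional `φ` that vanishes on every
commutator with the Hamiltonian and on every Pauli string too wide for `k` consecutive sites. If `φ`
also vanishes on all strings whose two ends span exactly `k` sites, then `Q` is a sum of operators
of smaller support. So the task is to find enough commutators.

A string on a window is written as a product of bond operators `a₁, a₂, …` on consecutive bonds,
times its total product `c` at the last site; the `aⱼ` are its partial products. Commute the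
Hamiltonian with a string `D` on `k + 1` sites. Only the two bond terms that cancel an end of `D`
survive, and they relate a string on `k` sites to the string obtained by dropping its first letter
and appending a new one (`shift_relation`). If the first two letters commute, one of the two terms
is absent. Hence a letter `0`, or two equal neighbours, can be shifted to the left end, where it
forces `φ = 0` (`eq_zero_of_defect`). For `c ≠ 0` such a defect can always be appended
(`eq_zero_of_total_ne_zero`). Only doubling words survive, with `c = 0`, and on these `φ` is a
shift-invariant multiple of the product of the couplings (`shift_invariance`).

Now let `h c ≠ 0` and let `x`, `c + x` be the other two axes, with different couplings. Commutators
with strings on `k` sites of total product `c` bring in the field (`field_relation`): two values of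
`φ` on strings of `k - 1` sites, plus a field term which, by shift invariance, is proportional to `h
c * (J (c + x) - J x)` and to the value of `φ` on a fixed doubling word `B` ending in `c`. Let the
window slide along `B` followed by `x, 0, x, 0, …`. The values on `k - 1` sites telescope, both
boundary terms vanish because a commutator does, and the `k - 1` field terms add up instead of
cancelling (`chain_relation`). Therefore `φ` vanishes on `B`, and by one more shift on all doubling
words. The classification applies this to each of the three axes. -/

/-- Labels of the Pauli matrices: `0` is the identity, and the product of two Pauli matrices is,
up to a phase, the Pauli matrix labelled by the sum of the labels. -/
abbrev PauliLabel : Type := ZMod 2 × ZMod 2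

/-! ### Multiplication and commutation of single Pauli matrices. -/

namespace PauliLabel

/-- The Pauli matrix with a given label. -/
def mat (a : PauliLabel) : Matrix (Fin 2) (Fin 2) ℂ :=
  if a = (0, 0) then 1 else if a = (1, 0) then pauliX else if a = (0, 1) then pauliZ else pauliY

/-- The phase in the product of two Pauli matrices. -/
def phase (a b : PauliLabel) : ℂ :=
  if a = 0 ∨ b = 0 ∨ a = b then 1
  else if (a = (1, 0) ∧ b = (1, 1)) ∨ (a = (1, 1) ∧ b = (0, 1)) ∨ (a = (0, 1) ∧ b = (1, 0))
    then Complex.I else -Complex.I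

/-- The sign with which two Pauli matrices commute. -/
def commSign (a b : PauliLabel) : ℂ :=
  if a = 0 ∨ b = 0 ∨ a = b then 1 else -1

theorem cases_label (a : PauliLabel) : a = (0, 0) ∨ a = (1, 0) ∨ a = (0, 1) ∨ a = (1, 1) := by
  revert a; decide

@[simp] theorem add_self (a : PauliLabel) : a + a = 0 := by
  revert a; decide

@[simp] theorem add_self_add (a b : PauliLabel) : a + (a + b) = b := by
  revert a b; decide

theorem add_eq_zero_iff_eq (a b : PauliLabel) : a + b = 0 ↔ a = b := by
  revert a b; decide

theorem mat_zero : mat 0 = 1 := by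
  simp [mat, ← Prod.mk_zero_zero]

theorem mat_mul (a b : PauliLabel) : mat a * mat b = phase a b • mat (a + b) := by
  have h2 : (1 : ZMod 2) + 1 = 0 := by decide
  rcases cases_label a with rfl | rfl | rfl | rfl <;> rcases cases_label b with rfl | rfl | rfl | rfl <;>
    simp [mat, phase, h2, ← Prod.mk_zero_zero] <;> ext i j <;> fin_cases i <;> fin_cases j <;>
    simp [pauliX, pauliY, pauliZ]

theorem phase_ne_zero (a b : PauliLabel) : phase a b ≠ 0 := by
  unfold phase; split_ifs <;> simp

theorem phase_self (a : PauliLabel) : phase a a = 1 := by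
  simp [phase]

theorem phase_zero_left (a : PauliLabel) : phase 0 a = 1 := by
  simp [phase]

theorem phase_zero_right (a : PauliLabel) : phase a 0 = 1 := by
  simp [phase]

theorem phase_swap (a b : PauliLabel) : phase a b = commSign a b * phase b a := by
  rcases cases_label a with rfl | rfl | rfl | rfl <;> rcases cases_label b with rfl | rfl | rfl | rfl <;>
    simp [phase, commSign, ← Prod.mk_zero_zero]

/-- The cyclic symmetry of the Levi-Civita symbol. It is the reason why no phase appears when a
Pauli matrix moves through a bond operator in `pauliAt_mul_bondOp`. -/
theorem phase_rotate (c e : PauliLabel) : phase c e = phase (c + e) c := by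
  have h2 : (1 : ZMod 2) + 1 = 0 := by decide
  rcases cases_label c with rfl | rfl | rfl | rfl <;> rcases cases_label e with rfl | rfl | rfl | rfl <;>
    simp [phase, h2, ← Prod.mk_zero_zero]

theorem commSign_zero_right (a : PauliLabel) : commSign a 0 = 1 := by
  simp [commSign]

theorem commSign_zero_left (a : PauliLabel) : commSign 0 a = 1 := by
  simp [commSign]

theorem commSign_self (a : PauliLabel) : commSign a a = 1 := by
  simp [commSign]

theorem commSign_of_ne {a b : PauliLabel} (ha : a ≠ 0) (hb : b ≠ 0) (hab : a ≠ b) :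
    commSign a b = -1 := by
  simp [commSign, ha, hb, hab]

theorem trace_mat_mul_completeness (i j l m : Fin 2) :
    ∑ a : PauliLabel, mat a i j * mat a l m = if i = m ∧ j = l then 2 else 0 := by
  have h : (Finset.univ : Finset PauliLabel) = {(0, 0), (1, 0), (0, 1), (1, 1)} := by decide
  rw [h]
  fin_cases i <;> fin_cases j <;> fin_cases l <;> fin_cases m <;>
    simp [mat, pauliX, pauliY, pauliZ] <;> norm_num

theorem exists_ne_ne (a b : PauliLabel) : ∃ e : PauliLabel, e ≠ a ∧ e ≠ b := by
  revert a b; decide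

end PauliLabel

/-! ### Pauli strings as an operator basis, and their supports. -/

section Strings

variable {N : ℕ} [NeZero N]

/-- The tensor product of Pauli matrices with given labels. -/
def pauliString (p : ZMod N → PauliLabel) : ChainOp N :=
  fun s t => ∏ i, PauliLabel.mat (p i) (s i) (t i)

theorem pauliString_mul (p q : ZMod N → PauliLabel) :
    pauliString p * pauliString q
      = (∏ i, PauliLabel.phase (p i) (q i)) • pauliString (p + q) := by
  ext s t
  simp only [Matrix.mul_apply, pauliString, Matrix.smul_apply, smul_eq_mul, Pi.add_apply,
    ← Finset.prod_mul_distrib]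
  have h := Finset.prod_univ_sum (fun _ : ZMod N => (Finset.univ : Finset (Fin 2)))
    (fun i r => PauliLabel.mat (p i) (s i) r * PauliLabel.mat (q i) r (t i))
  rw [Fintype.piFinset_univ] at h
  rw [← h]
  refine Finset.prod_congr rfl fun i _ => ?_
  rw [← Matrix.mul_apply, PauliLabel.mat_mul]
  rfl

theorem pauliString_zero : pauliString (0 : ZMod N → PauliLabel) = 1 := by
  ext s t
  simp only [pauliString, Pi.zero_apply, PauliLabel.mat_zero, Matrix.one_apply]
  by_cases h : s = t
  · simp [h]
  · rw [if_neg h]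
    obtain ⟨i, hi⟩ := Function.ne_iff.mp h
    exact Finset.prod_eq_zero (Finset.mem_univ i) (if_neg hi)

theorem siteOp_mat (a : PauliLabel) (i : ZMod N) :
    siteOp (PauliLabel.mat a) i = pauliString (Pi.single i a) := by
  ext s t
  simp only [siteOp, pauliString]
  split_ifs with h
  · rw [Finset.prod_eq_single i]
    · simp
    · intro j _ hj
      simp [Pi.single_eq_of_ne hj, PauliLabel.mat_zero, h j hj]
    · simp
  · push Not at h
    obtain ⟨j, hj, hst⟩ := h
    symm
    refine Finset.prod_eq_zero (Finset.mem_univ j) ?_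
    simp [Pi.single_eq_of_ne hj, PauliLabel.mat_zero, hst]

theorem sum_pauliString_mul (s t u v : SpinConfig N) :
    ∑ p : ZMod N → PauliLabel, pauliString p s t * pauliString p u v
      = if s = v ∧ t = u then 2 ^ N else 0 := by
  simp only [pauliString, ← Finset.prod_mul_distrib]
  have h := Finset.prod_univ_sum (fun _ : ZMod N => (Finset.univ : Finset PauliLabel))
    (fun i a => PauliLabel.mat a (s i) (t i) * PauliLabel.mat a (u i) (v i))
  rw [Fintype.piFinset_univ] at h
  rw [← h]
  simp only [PauliLabel.trace_mat_mul_completeness]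
  split_ifs with hst
  · simp [hst.1, hst.2, ZMod.card]
  · have : ∃ i, ¬ (s i = v i ∧ t i = u i) := by
      by_contra hc
      push Not at hc
      exact hst ⟨funext fun i => (hc i).1, funext fun i => (hc i).2⟩
    obtain ⟨i, hi⟩ := this
    exact Finset.prod_eq_zero (Finset.mem_univ i) (if_neg hi)

/-- Pauli strings form an orthogonal basis of the operators. -/
theorem sum_trace_smul_pauliString (Q : ChainOp N) :
    ∑ p : ZMod N → PauliLabel, (Q * pauliString p).trace • pauliString p = (2 : ℂ) ^ N • Q := by
  ext u v
  simp only [Matrix.sum_apply, Matrix.smul_apply, smul_eq_mul, Matrix.trace, Matrix.diag_apply,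
    Matrix.mul_apply, Finset.sum_mul]
  rw [Finset.sum_comm]
  calc _ = ∑ s, ∑ t, Q s t * ∑ p : ZMod N → PauliLabel, pauliString p t s * pauliString p u v := by
        refine Finset.sum_congr rfl fun s _ => ?_
        rw [Finset.sum_comm]
        refine Finset.sum_congr rfl fun t _ => ?_
        rw [Finset.mul_sum]
        exact Finset.sum_congr rfl fun p _ => by ring
    _ = _ := by
        simp only [sum_pauliString_mul]
        rw [Finset.sum_eq_single u, Finset.sum_eq_single v]
        · simp [mul_comm]
        · intro t _ ht; simp [ht]
        · simp
        · intro s _ hs; simp [hs]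
        · simp

theorem actsOn_pauliString {S : Finset (ZMod N)} {p : ZMod N → PauliLabel}
    (h : ∀ j, j ∉ S → p j = 0) : ActsOn S (pauliString p) := by
  refine ⟨fun s t => ∏ j : S, PauliLabel.mat (p j) (s j) (t j), fun s t => ?_⟩
  simp only [pauliString]
  split_ifs with hst
  · rw [Finset.prod_coe_sort S (fun j => PauliLabel.mat (p j) (s j) (t j))]
    symm
    refine Finset.prod_subset (Finset.subset_univ S) fun j _ hj => ?_
    simp [h j hj, PauliLabel.mat_zero, hst j hj]
  · push Not at hst
    obtain ⟨j, hj, hne⟩ := hst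
    refine Finset.prod_eq_zero (Finset.mem_univ j) ?_
    simp [h j hj, PauliLabel.mat_zero, hne]

theorem ActsOn.commute_siteOp {S : Finset (ZMod N)} {A : ChainOp N} (hA : ActsOn S A)
    {j : ZMod N} (hj : j ∉ S) (τ : Matrix (Fin 2) (Fin 2) ℂ) : Commute A (siteOp τ j) := by
  obtain ⟨B, hB⟩ := hA
  ext s t
  have hS : ∀ m : S, (m : ZMod N) ≠ j := fun m hm => hj (hm ▸ m.2)
  rw [Matrix.mul_apply, Matrix.mul_apply,
    Finset.sum_eq_single (Function.update t j (s j)),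
    Finset.sum_eq_single (Function.update s j (t j))]
  · rw [hB, hB, mul_comm]
    have e1 : (fun m : S => Function.update t j (s j) m) = fun m : S => t m :=
      funext fun m => by simp [Function.update_of_ne (hS m)]
    have e2 : (fun m : S => Function.update s j (t j) m) = fun m : S => s m :=
      funext fun m => by simp [Function.update_of_ne (hS m)]
    rw [e1, e2]
    have e3 : (∀ m, m ∉ S → s m = Function.update t j (s j) m)
        ↔ (∀ m, m ∉ S → Function.update s j (t j) m = t m) := by
      refine forall_congr' fun m => forall_congr' fun _ => ?_
      by_cases hm : m = j
      · subst hm; simp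
      · simp [Function.update_of_ne hm]
    simp only [e3, siteOp]
    congr 1
    simp +contextual [Function.update_of_ne]
  · intro r _ hr
    by_contra hne
    apply hr
    rw [siteOp, hB] at hne
    have h1 : ∀ m, m ≠ j → s m = r m := by
      by_contra hc; simp [hc] at hne
    have h2 : ∀ m, m ∉ S → r m = t m := by
      by_contra hc; simp [hc] at hne
    ext m : 1
    by_cases hm : m = j
    · subst hm; simp [h2 m hj]
    · rw [Function.update_of_ne hm, h1 m hm]
  · simp
  · intro r _ hr
    by_contra hne
    apply hr
    rw [siteOp, hB] at hne
    have h1 : ∀ m, m ≠ j → r m = t m := by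
      by_contra hc; simp [hc] at hne
    have h2 : ∀ m, m ∉ S → s m = r m := by
      by_contra hc; simp [hc] at hne
    ext m : 1
    by_cases hm : m = j
    · subst hm; simp [h2 m hj]
    · rw [Function.update_of_ne hm, h1 m hm]
  · simp

theorem pauliString_single_mul (a : PauliLabel) (j : ZMod N) (p : ZMod N → PauliLabel) :
    pauliString (Pi.single j a) * pauliString p
      = PauliLabel.phase a (p j) • pauliString (Pi.single j a + p) := by
  rw [pauliString_mul, Finset.prod_eq_single j]
  · simp
  · intro i _ hi
    simp [Pi.single_eq_of_ne hi, PauliLabel.phase_zero_left]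
  · simp

theorem pauliString_mul_single (a : PauliLabel) (j : ZMod N) (p : ZMod N → PauliLabel) :
    pauliString p * pauliString (Pi.single j a)
      = PauliLabel.phase (p j) a • pauliString (Pi.single j a + p) := by
  rw [pauliString_mul, Finset.prod_eq_single j]
  · simp [add_comm]
  · intro i _ hi
    simp [Pi.single_eq_of_ne hi, PauliLabel.phase_zero_right]
  · simp

theorem pauliString_single_comm (a : PauliLabel) (j : ZMod N) (p : ZMod N → PauliLabel) :
    pauliString (Pi.single j a) * pauliString p
      = PauliLabel.commSign a (p j) • (pauliString p * pauliString (Pi.single j a)) := by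
  rw [pauliString_single_mul, pauliString_mul_single, smul_smul, PauliLabel.phase_swap]

/-- A Pauli matrix at site `j` that differs from `p j` commutes with `A` and anticommutes with the
string, so conjugation by it reverses the sign of the trace. -/
theorem ActsOn.trace_mul_pauliString {S : Finset (ZMod N)} {A : ChainOp N} (hA : ActsOn S A)
    {p : ZMod N → PauliLabel} {j : ZMod N} (hj : j ∉ S) (hp : p j ≠ 0) :
    (A * pauliString p).trace = 0 := by
  obtain ⟨a, ha0, hap⟩ := PauliLabel.exists_ne_ne 0 (p j)
  set g : ChainOp N := pauliString (Pi.single j a) with hg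
  have hgg : g * g = 1 := by
    rw [hg, pauliString_single_mul]
    simp [PauliLabel.phase_self, ← Pi.single_add, pauliString_zero]
  have hAg : A * g = g * A := by
    have := hA.commute_siteOp hj (PauliLabel.mat a)
    rwa [siteOp_mat] at this
  have hgp : g * pauliString p = -(pauliString p * g) := by
    rw [hg, pauliString_single_comm, PauliLabel.commSign_of_ne ha0 hp hap, neg_one_smul]
  have h : (A * pauliString p).trace = -(A * pauliString p).trace := by
    calc (A * pauliString p).trace = (A * pauliString p * g * g).trace := by
          rw [mul_assoc _ g g, hgg, mul_one]
      _ = (g * (A * pauliString p * g)).trace := Matrix.trace_mul_comm _ _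
      _ = (A * (g * pauliString p) * g).trace := by
          rw [← mul_assoc, ← mul_assoc, ← hAg, mul_assoc A g]
      _ = -(A * pauliString p).trace := by
          rw [hgp, mul_neg, neg_mul, Matrix.trace_neg, mul_assoc A, mul_assoc _ g g, hgg, mul_one]
  exact self_eq_neg.mp h

end Strings

/-! ### Pauli strings on a window as words of bond operators. -/

section Words

variable {N : ℕ}

theorem natCast_ne_of_lt {m n : ℕ} (hm : m < N) (hn : n < N) (h : m ≠ n) :
    (m : ZMod N) ≠ n := by
  intro hc
  rw [ZMod.natCast_eq_natCast_iff', Nat.mod_eq_of_lt hm, Nat.mod_eq_of_lt hn] at hc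
  exact h hc

theorem site_ne_succ (hN : 2 ≤ N) (i : ZMod N) : i ≠ i + 1 := by
  have h := natCast_ne_of_lt (N := N) (m := 0) (n := 1) (by omega) (by omega) (by omega)
  intro hc
  rw [left_eq_add] at hc
  simp [hc] at h

variable [NeZero N]

/-- The Pauli matrix with label `a` at site `j`. -/
def pauliAt (a : PauliLabel) (j : ZMod N) : ChainOp N := pauliString (Pi.single j a)

/-- The bond operator with label `a` on the sites `j` and `j + 1`. -/
def bondOp (a : PauliLabel) (j : ZMod N) : ChainOp N := pauliAt a j * pauliAt a (j + 1)

/-- The labels of the bond operator. -/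
def bondString (a : PauliLabel) (j : ZMod N) : ZMod N → PauliLabel :=
  Pi.single j a + Pi.single (j + 1) a

/-- The product of the bond operators with labels in the list on the consecutive bonds that start
at site `i`, times the Pauli matrix with label `c` at the last site. Up to a phase, the list
consists of the partial products of the Pauli string from the left, and `c` is its total product. -/
def wordOp (c : PauliLabel) : ZMod N → List PauliLabel → ChainOp N
  | i, [] => pauliAt c i
  | i, a :: w => bondOp a i * wordOp c (i + 1) w

/-- The labels of the Pauli string `wordOp c i w`. -/
def wordString (c : PauliLabel) : ZMod N → List PauliLabel → ZMod N → PauliLabel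
  | i, [] => Pi.single i c
  | i, a :: w => bondString a i + wordString c (i + 1) w

theorem pauliAt_zero (j : ZMod N) : pauliAt 0 j = 1 := by
  simp [pauliAt, pauliString_zero]

theorem pauliAt_mul_same (a b : PauliLabel) (j : ZMod N) :
    pauliAt a j * pauliAt b j = PauliLabel.phase a b • pauliAt (a + b) j := by
  simp [pauliAt, pauliString_single_mul, ← Pi.single_add]

theorem pauliAt_mul_self (a : PauliLabel) (j : ZMod N) : pauliAt a j * pauliAt a j = 1 := by
  simp [pauliAt_mul_same, PauliLabel.phase_self, pauliAt_zero]

theorem pauliAt_comm_pauliString (a : PauliLabel) (j : ZMod N) (p : ZMod N → PauliLabel) :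
    pauliAt a j * pauliString p
      = PauliLabel.commSign a (p j) • (pauliString p * pauliAt a j) :=
  pauliString_single_comm a j p

theorem pauliAt_commute {j l : ZMod N} (h : j ≠ l) (a b : PauliLabel) :
    pauliAt a j * pauliAt b l = pauliAt b l * pauliAt a j := by
  rw [pauliAt, pauliAt, pauliString_single_comm, Pi.single_eq_of_ne h,
    PauliLabel.commSign_zero_right, one_smul]

theorem bondOp_comm_pauliString (a : PauliLabel) (j : ZMod N) (p : ZMod N → PauliLabel) :
    bondOp a j * pauliString p
      = (PauliLabel.commSign a (p j) * PauliLabel.commSign a (p (j + 1)))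
        • (pauliString p * bondOp a j) := by
  rw [bondOp, mul_assoc, pauliAt_comm_pauliString, mul_smul_comm, ← mul_assoc,
    pauliAt_comm_pauliString, smul_mul_assoc, smul_smul, mul_assoc, mul_comm]

theorem bondOp_mul_self (hN : 2 ≤ N) (a : PauliLabel) (j : ZMod N) :
    bondOp a j * bondOp a j = 1 := by
  have hj := site_ne_succ hN j
  rw [bondOp, mul_assoc, ← mul_assoc (pauliAt a (j + 1)), ← pauliAt_commute hj, mul_assoc,
    pauliAt_mul_self, mul_one, pauliAt_mul_self]

theorem pauliAt_mul_bondOp (c e : PauliLabel) (j : ZMod N) :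
    pauliAt c j * bondOp e j = bondOp (c + e) j * pauliAt c (j + 1) := by
  rw [bondOp, bondOp, ← mul_assoc, pauliAt_mul_same, mul_assoc (pauliAt (c + e) j),
    pauliAt_mul_same, smul_mul_assoc, mul_smul_comm, PauliLabel.phase_rotate c e,
    add_comm (c + e) c, PauliLabel.add_self_add]

theorem exists_pauliAt_mul (a : PauliLabel) (j : ZMod N) (p : ZMod N → PauliLabel) :
    ∃ z : ℂ, z ≠ 0 ∧ pauliAt a j * pauliString p = z • pauliString (Pi.single j a + p) :=
  ⟨_, PauliLabel.phase_ne_zero _ _, pauliString_single_mul a j p⟩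

theorem exists_bondOp_mul (a : PauliLabel) (j : ZMod N) (p : ZMod N → PauliLabel) :
    ∃ z : ℂ, z ≠ 0 ∧ bondOp a j * pauliString p = z • pauliString (bondString a j + p) := by
  obtain ⟨z, hz, h⟩ := exists_pauliAt_mul a (j + 1) p
  obtain ⟨y, hy, h'⟩ := exists_pauliAt_mul a j (Pi.single (j + 1) a + p)
  refine ⟨z * y, mul_ne_zero hz hy, ?_⟩
  rw [bondOp, mul_assoc, h, mul_smul_comm, h', smul_smul, bondString, add_assoc]

theorem exists_wordOp_eq (c : PauliLabel) (i : ZMod N) (w : List PauliLabel) :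
    ∃ z : ℂ, z ≠ 0 ∧ wordOp c i w = z • pauliString (wordString c i w) := by
  induction w generalizing i with
  | nil => exact ⟨1, one_ne_zero, by simp [wordOp, wordString, pauliAt]⟩
  | cons a w ih =>
    obtain ⟨z, hz, h⟩ := ih (i + 1)
    obtain ⟨y, hy, h'⟩ := exists_bondOp_mul a i (wordString c (i + 1) w)
    exact ⟨z * y, mul_ne_zero hz hy, by
      rw [wordOp, h, mul_smul_comm, h', smul_smul, wordString]⟩

theorem wordOp_append (c : PauliLabel) (i : ZMod N) (x w : List PauliLabel) :
    wordOp c i (x ++ w) = wordOp 0 i x * wordOp c (i + (x.length : ZMod N)) w := by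
  induction x generalizing i with
  | nil => simp [wordOp, pauliAt_zero]
  | cons a x ih =>
    simp only [List.cons_append, wordOp, ih, List.length_cons, mul_assoc]
    push_cast
    rw [add_comm (x.length : ZMod N) 1, add_assoc]

theorem wordString_append (c : PauliLabel) (i : ZMod N) (x w : List PauliLabel) :
    wordString c i (x ++ w) = wordString 0 i x + wordString c (i + (x.length : ZMod N)) w := by
  induction x generalizing i with
  | nil => simp [wordString]
  | cons a x ih =>
    simp only [List.cons_append, wordString, ih, List.length_cons, add_assoc]
    push_cast
    rw [add_comm (x.length : ZMod N) 1]

/-- The total product `c` sits at the last site and has to move through the new bond, which turns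
the label `c + a` into `a`. -/
theorem wordOp_mul_bondOp (c a : PauliLabel) (i : ZMod N) (w : List PauliLabel) :
    wordOp c i w * bondOp (c + a) (i + (w.length : ZMod N)) = wordOp c i (w ++ [a]) := by
  have h := wordOp_append c i w []
  rw [List.append_nil] at h
  rw [h, wordOp_append c i w [a], mul_assoc]
  simp only [wordOp]
  rw [pauliAt_mul_bondOp, PauliLabel.add_self_add]

/-- Multiplication by a Pauli matrix at the first site of a word changes all its partial products
and its total product. -/
theorem pauliAt_mul_wordOp (c : PauliLabel) (j : ZMod N) (w : List PauliLabel) :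
    pauliAt c j * wordOp 0 j (w.map (c + ·)) = wordOp c j w := by
  induction w generalizing j with
  | nil => simp [wordOp, pauliAt_zero]
  | cons a w ih =>
    simp only [List.map_cons, wordOp]
    rw [← mul_assoc, pauliAt_mul_bondOp, PauliLabel.add_self_add, mul_assoc, ih]

theorem single_add_wordString (c : PauliLabel) (j : ZMod N) (w : List PauliLabel) :
    Pi.single j c + wordString c j w = wordString 0 j (w.map (c + ·)) := by
  induction w generalizing j with
  | nil => simp [wordString, ← Pi.single_add]
  | cons a w ih =>
    simp only [List.map_cons, wordString, ← ih, bondString, Pi.single_add]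
    have h : (Pi.single (j + 1) c : ZMod N → PauliLabel) + Pi.single (j + 1) c = 0 := by
      rw [← Pi.single_add, PauliLabel.add_self, Pi.single_zero]
    linear_combination (exp := 1) -h

theorem wordString_outside (c : PauliLabel) (i : ZMod N) (w : List PauliLabel) {m : ℕ}
    (hm : w.length < m) (hmN : m < N) : wordString c i w (i + (m : ZMod N)) = 0 := by
  induction w generalizing i m with
  | nil =>
    have : i + m ≠ i := by
      simpa using natCast_ne_of_lt hmN (n := 0) (by omega) (by simp at hm; omega)
    simp [wordString, Pi.single_eq_of_ne this]
  | cons a w ih =>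
    obtain ⟨m, rfl⟩ : ∃ l, m = l + 1 := ⟨m - 1, by omega⟩
    simp only [List.length_cons] at hm
    have h0 : i + ((m + 1 : ℕ) : ZMod N) ≠ i := by
      simpa using natCast_ne_of_lt hmN (n := 0) (by omega) (by omega)
    have h1 : i + ((m + 1 : ℕ) : ZMod N) ≠ i + 1 := by
      simpa using natCast_ne_of_lt hmN (n := 1) (by omega) (by omega)
    have h2 := ih (i + 1) (m := m) (by omega) (by omega)
    simp only [wordString, bondString, Pi.add_apply, Pi.single_eq_of_ne h0, Pi.single_eq_of_ne h1]
    rw [show i + ((m + 1 : ℕ) : ZMod N) = i + 1 + m by push_cast; ring, h2]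
    simp

theorem wordString_head (c : PauliLabel) (i : ZMod N) (a : PauliLabel) (w : List PauliLabel)
    (hw : w.length + 2 ≤ N) : wordString c i (a :: w) i = a := by
  have h1 := site_ne_succ (N := N) (by omega) i
  -- Going around the ring, site `i` is reached from `i + 1` by `N - 1` steps, so it lies outside
  -- the window of the shorter word.
  have h2 := wordString_outside c (i + 1) w (m := N - 1) (by omega) (by omega)
  rw [show i + 1 + ((N - 1 : ℕ) : ZMod N) = i by
    rw [Nat.cast_sub (by omega)]; simp] at h2
  simp [wordString, bondString, Pi.single_eq_of_ne h1, h2]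

theorem wordString_append_at (c : PauliLabel) (i : ZMod N) (x : List PauliLabel)
    (a e : PauliLabel) (y : List PauliLabel) (h : x.length + y.length + 3 ≤ N) :
    wordString c i ((x ++ [a]) ++ e :: y) (i + ((x.length + 1 : ℕ) : ZMod N)) = a + e := by
  rw [wordString_append]
  simp only [Pi.add_apply, List.length_append, List.length_singleton]
  rw [wordString_head _ _ _ _ (by omega)]
  rw [wordString_append, Pi.add_apply, wordString_outside _ _ _ (by omega) (by omega)]
  simp [wordString, bondString]
  have h1 : i + ((x.length : ZMod N) + 1) ≠ i + x.length := by
    rw [← add_assoc]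
    exact (site_ne_succ (by omega) _).symm
  rw [Pi.single_eq_of_ne h1, add_assoc, Pi.single_eq_same, zero_add]

theorem wordString_last (c : PauliLabel) (i : ZMod N) (x : List PauliLabel)
    (a : PauliLabel) (h : x.length + 3 ≤ N) :
    wordString c i (x ++ [a]) (i + ((x.length + 1 : ℕ) : ZMod N)) = a + c := by
  have h2 := wordString_append c i (x ++ [a]) []
  rw [List.append_nil] at h2
  have h3 := wordString_append_at c i x a c [] (by simpa using h)
  rw [wordString_append, Pi.add_apply] at h3
  rw [h2, Pi.add_apply]
  convert h3 using 2
  simp only [List.length_append, List.length_singleton]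
  rw [wordString_head _ _ _ _ (by simp; omega)]
  simp [wordString]

theorem sum_wordString (c : PauliLabel) (i : ZMod N) (w : List PauliLabel) :
    ∑ j, wordString c i w j = c := by
  induction w generalizing i with
  | nil => simp [wordString]
  | cons a w ih => simp [wordString, bondString, Finset.sum_add_distrib, ih]

/-- Every Pauli string on a window is given by a word. -/
theorem exists_wordString_eq (n : ℕ) (i : ZMod N) (p : ZMod N → PauliLabel) (hn : n < N)
    (hp : ∀ m : ℕ, n < m → m < N → p (i + m) = 0) :
    ∃ c w, w.length = n ∧ p = wordString c i w := by
  induction n generalizing i p with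
  | zero =>
    refine ⟨p i, [], rfl, funext fun j => ?_⟩
    by_cases hj : j = i
    · simp [hj, wordString]
    · have h := hp (j - i).val (Nat.pos_of_ne_zero fun h => hj (by
        rw [ZMod.val_eq_zero] at h; exact sub_eq_zero.mp h)) (ZMod.val_lt _)
      simp only [ZMod.natCast_val, ZMod.cast_id', id, add_sub_cancel] at h
      simp [wordString, h, Pi.single_eq_of_ne hj]
  | succ n ih =>
    have h01 := site_ne_succ (N := N) (by omega) i
    obtain ⟨c, w, hw, h⟩ := ih (i + 1) (bondString (p i) i + p) (by omega) (by
      intro m hm hmN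
      rcases eq_or_lt_of_le (show m + 1 ≤ N by omega) with hm' | hm'
      · have e : i + 1 + (m : ZMod N) = i := by
          have : ((m + 1 : ℕ) : ZMod N) = 0 := by rw [hm']; simp
          push_cast at this
          rw [add_assoc, add_comm (1 : ZMod N), this, add_zero]
        rw [e]
        simp [bondString, Pi.single_eq_of_ne h01]
      · have e : i + 1 + (m : ZMod N) = i + ((m + 1 : ℕ) : ZMod N) := by push_cast; ring
        have h0 : i + ((m + 1 : ℕ) : ZMod N) ≠ i := by
          simpa using natCast_ne_of_lt hm' (n := 0) (by omega) (by omega)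
        have h1 : i + ((m + 1 : ℕ) : ZMod N) ≠ i + 1 := by
          simpa using natCast_ne_of_lt hm' (n := 1) (by omega) (by omega)
        rw [e, Pi.add_apply, hp _ (by omega) hm']
        simp only [bondString, Pi.add_apply, Pi.single_eq_of_ne h0, Pi.single_eq_of_ne h1]
        simp)
    refine ⟨c, p i :: w, by simp [hw], ?_⟩
    rw [wordString, ← h, ← add_assoc]
    have : bondString (p i) i + bondString (p i) i = 0 := by
      ext1 j; exact PauliLabel.add_self _
    rw [this, zero_add]

end Words

/-! ### Commutators of the terms of the Hamiltonian with words. -/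

section Brackets

variable {N : ℕ} [NeZero N]

/-- The Hamiltonian with given coefficients of the bond operators and of the one-site Pauli
matrices. -/
def pauliHamiltonian (N : ℕ) [NeZero N] (J h : PauliLabel → ℂ) : ChainOp N :=
  ∑ s : ZMod N, ∑ a : PauliLabel, (J a • bondOp a s + h a • pauliAt a s)

/-- A linear functional that vanishes on all commutators with the Hamiltonian, and on all Pauli
strings that act on two sites whose distance is at least `k` in both directions of the ring. -/
structure IsLocalConserved (k : ℕ) (J h : PauliLabel → ℂ) (φ : ChainOp N →ₗ[ℂ] ℂ) : Prop where
  bracket : ∀ D : ChainOp N, φ ⁅pauliHamiltonian N J h, D⁆ = 0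
  far : ∀ (p : ZMod N → PauliLabel) (i : ZMod N) (m : ℕ), k ≤ m → m + k ≤ N →
    p i ≠ 0 → p (i + m) ≠ 0 → φ (pauliString p) = 0

theorem PauliLabel.commSign_ne_one {a b : PauliLabel} (h : commSign a b ≠ 1) :
    a ≠ 0 ∧ b ≠ 0 ∧ a ≠ b := by
  unfold commSign at h
  split_ifs at h with h'
  · exact absurd rfl h
  · push Not at h'
    exact h'

theorem IsLocalConserved.sum_brackets {k : ℕ} {J h : PauliLabel → ℂ} {φ : ChainOp N →ₗ[ℂ] ℂ}
    (H : IsLocalConserved k J h φ) (D : ChainOp N) :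
    ∑ s : ZMod N, ∑ a : PauliLabel, J a * φ ⁅bondOp a s, D⁆
      + ∑ s : ZMod N, ∑ a : PauliLabel, h a * φ ⁅pauliAt a s, D⁆ = 0 := by
  rw [← H.bracket D, pauliHamiltonian]
  simp only [Ring.lie_def, Finset.sum_mul, Finset.mul_sum, ← Finset.sum_add_distrib,
    ← Finset.sum_sub_distrib, map_sum]
  refine Finset.sum_congr rfl fun s _ => Finset.sum_congr rfl fun a _ => ?_
  rw [add_mul, mul_add]
  simp only [smul_mul_assoc, mul_smul_comm, map_add, map_sub, map_smul, smul_eq_mul]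
  ring

/-- Pauli strings commute or anticommute, so the bracket is either zero or a multiple of the product
string; only the second case needs a hypothesis on `φ`. -/
theorem map_bondOp_bracket_eq_zero (φ : ChainOp N →ₗ[ℂ] ℂ) (b c : PauliLabel) (s i : ZMod N)
    (w : List PauliLabel)
    (h : b ≠ 0 → PauliLabel.commSign b (wordString c i w s)
      * PauliLabel.commSign b (wordString c i w (s + 1)) ≠ 1 →
      φ (pauliString (bondString b s + wordString c i w)) = 0) :
    φ ⁅bondOp b s, wordOp c i w⁆ = 0 := by
  obtain ⟨z, -, hz⟩ := exists_wordOp_eq c i w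
  obtain ⟨y, hy, hy'⟩ := exists_bondOp_mul b s (wordString c i w)
  have hcomm := bondOp_comm_pauliString b s (wordString c i w)
  set χ := PauliLabel.commSign b (wordString c i w s)
      * PauliLabel.commSign b (wordString c i w (s + 1)) with hχ
  rw [hz, Ring.lie_def, mul_smul_comm, smul_mul_assoc, ← smul_sub, map_smul]
  by_cases h1 : χ = 1
  · rw [h1, one_smul] at hcomm
    simp [hcomm]
  · have hb : b ≠ 0 := by
      rintro rfl
      simp [hχ, PauliLabel.commSign_zero_left] at h1
    have h0 := h hb h1
    have hχ0 : χ ≠ 0 := by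
      rw [hχ]; unfold PauliLabel.commSign; split_ifs <;> simp
    have e : pauliString (wordString c i w) * bondOp b s
        = χ⁻¹ • (bondOp b s * pauliString (wordString c i w)) := by
      rw [hcomm, smul_smul, inv_mul_cancel₀ hχ0, one_smul]
    rw [e, hy']
    simp [h0]

theorem map_pauliAt_bracket_eq_zero (φ : ChainOp N →ₗ[ℂ] ℂ) (b c : PauliLabel) (s i : ZMod N)
    (w : List PauliLabel)
    (h : b ≠ 0 → wordString c i w s ≠ 0 → b ≠ wordString c i w s →
      φ (pauliString (Pi.single s b + wordString c i w)) = 0) :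
    φ ⁅pauliAt b s, wordOp c i w⁆ = 0 := by
  obtain ⟨z, -, hz⟩ := exists_wordOp_eq c i w
  rw [hz, Ring.lie_def, mul_smul_comm, smul_mul_assoc, ← smul_sub, map_smul]
  by_cases h1 : PauliLabel.commSign b (wordString c i w s) = 1
  · rw [pauliAt_comm_pauliString, h1]
    simp
  · obtain ⟨h2, h3, h4⟩ := PauliLabel.commSign_ne_one h1
    simp [pauliAt, pauliString_single_mul, pauliString_mul_single, h h2 h3 h4]

/-- The bond operator squares to `1`, and it meets the rest of the word only at site `i + 1`, where
that rest has the label `b`. -/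
theorem bondOp_bracket_left (a b c : PauliLabel) (i : ZMod N) (v : List PauliLabel)
    (hv : v.length + 3 ≤ N) :
    ⁅bondOp a i, wordOp c i (a :: b :: v)⁆
      = (1 - PauliLabel.commSign a b) • wordOp c (i + 1) (b :: v) := by
  obtain ⟨z, -, hz⟩ := exists_wordOp_eq c (i + 1) (b :: v)
  have h0 := wordString_outside c (i + 1) (b :: v) (m := N - 1) (by simp; omega) (by omega)
  rw [show i + 1 + ((N - 1 : ℕ) : ZMod N) = i by
    rw [Nat.cast_sub (by omega)]; simp] at h0
  have h1 := wordString_head c (i + 1) b v (by omega)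
  have hc : bondOp a i * wordOp c (i + 1) (b :: v)
      = PauliLabel.commSign a b • (wordOp c (i + 1) (b :: v) * bondOp a i) := by
    rw [hz, mul_smul_comm, bondOp_comm_pauliString, h0, h1, PauliLabel.commSign_zero_right,
      one_mul, smul_mul_assoc, smul_comm]
  have hbb := bondOp_mul_self (by omega : 2 ≤ N) a i
  rw [wordOp, Ring.lie_def, ← mul_assoc, hbb, one_mul, hc, smul_mul_assoc, mul_assoc, hbb, mul_one,
    sub_smul, one_smul]

/-- The last bond acts with label `c + e`, the last Pauli matrix of the string, and meets the
shortened word only at that word's last site, whose label is `a + c`. -/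
theorem bondOp_bracket_right (a c e : PauliLabel) (i : ZMod N) (x : List PauliLabel)
    (hx : x.length + 3 ≤ N) :
    ⁅bondOp (c + e) (i + ((x.length + 1 : ℕ) : ZMod N)), wordOp c i ((x ++ [a]) ++ [e])⁆
      = (PauliLabel.commSign (c + e) (a + c) - 1) • wordOp c i (x ++ [a]) := by
  obtain ⟨z, -, hz⟩ := exists_wordOp_eq c i (x ++ [a])
  have h0 := wordString_outside c i (x ++ [a]) (m := x.length + 2) (by simp) (by omega)
  have h1 := wordString_last c i x a hx
  have hD := wordOp_mul_bondOp c e i (x ++ [a])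
  simp only [List.length_append, List.length_singleton] at hD
  set j := i + ((x.length + 1 : ℕ) : ZMod N) with hj
  rw [show i + ((x.length + 2 : ℕ) : ZMod N) = j + 1 by rw [hj]; push_cast; ring] at h0
  have hc : bondOp (c + e) j * wordOp c i (x ++ [a])
      = PauliLabel.commSign (c + e) (a + c) • (wordOp c i (x ++ [a]) * bondOp (c + e) j) := by
    rw [hz, mul_smul_comm, bondOp_comm_pauliString, h0, h1, PauliLabel.commSign_zero_right,
      mul_one, smul_mul_assoc, smul_comm]
  have hbb := bondOp_mul_self (by omega : 2 ≤ N) (c + e) j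
  rw [← hD, Ring.lie_def, ← mul_assoc, hc, smul_mul_assoc, mul_assoc, hbb, mul_one, sub_smul,
    one_smul]

theorem single_add_natCast_apply (b : PauliLabel) (i : ZMod N) {t m : ℕ} (ht : t < N) (hm : m < N) :
    (Pi.single (i + (t : ZMod N)) b : ZMod N → PauliLabel) (i + m) = if m = t then b else 0 := by
  split_ifs with h
  · rw [h, Pi.single_eq_same]
  · exact Pi.single_eq_of_ne (by simpa using natCast_ne_of_lt hm ht h) _

theorem bondString_add_natCast_apply (b : PauliLabel) (i : ZMod N) {t m : ℕ} (ht : t < N)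
    (hm : m < N) :
    bondString b (i + (t : ZMod N)) (i + (m : ZMod N))
      = (if m = t then b else 0) + (if m = (t + 1) % N then b else 0) := by
  -- The bond at offset `N - 1` closes the ring and ends at offset `0`, hence the remainder modulo
  -- `N`.
  have h : i + (t : ZMod N) + 1 = i + (((t + 1) % N : ℕ) : ZMod N) := by
    rw [ZMod.natCast_mod]; push_cast; ring
  rw [bondString, Pi.add_apply, single_add_natCast_apply b i ht hm, h,
    single_add_natCast_apply b i (Nat.mod_lt _ (by omega)) hm]

theorem exists_eq_add_natCast (i s : ZMod N) : ∃ t : ℕ, t < N ∧ s = i + (t : ZMod N) :=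
  ⟨(s - i).val, ZMod.val_lt _, by simp⟩

/-- A bond operator that anticommutes with a Pauli string on the window `i, …, i + n`, and does not
cancel one of the two ends of the string, either acts within the window, or enlarges it. -/
theorem bondString_add_ends {n : ℕ} {i : ZMod N} {d : ZMod N → PauliLabel} (hn : 2 ≤ n)
    (hnN : n + 3 ≤ N) (h0 : d i ≠ 0) (h1 : d (i + n) ≠ 0)
    (hd : ∀ m : ℕ, n < m → m < N → d (i + m) = 0) {b : PauliLabel} {s : ZMod N} (hb : b ≠ 0)
    (hs : PauliLabel.commSign b (d s) * PauliLabel.commSign b (d (s + 1)) ≠ 1)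
    (hleft : ¬ (s = i ∧ b = d i)) (hright : ¬ (s = i + ((n - 1 : ℕ) : ZMod N) ∧ b = d (i + n))) :
    (bondString b s + d) i ≠ 0 ∧ (bondString b s + d) (i + n) ≠ 0 ∧
    ((∃ t : ℕ, t < n ∧ s = i + t) ∨ (bondString b s + d) (i + ((n + 1 : ℕ) : ZMod N)) ≠ 0
      ∨ (bondString b s + d) (i + ((N - 1 : ℕ) : ZMod N)) ≠ 0) := by
  obtain ⟨t, ht, rfl⟩ := exists_eq_add_natCast i s
  have hs1 : i + (t : ZMod N) + 1 = i + (((t + 1) % N : ℕ) : ZMod N) := by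
    rw [ZMod.natCast_mod]; push_cast; ring
  rw [hs1] at hs
  have hi : (bondString b (i + (t : ZMod N)) + d) i
      = bondString b (i + (t : ZMod N)) (i + ((0 : ℕ) : ZMod N)) + d i := by simp
  rw [hi, Pi.add_apply, Pi.add_apply, Pi.add_apply, bondString_add_natCast_apply b i ht (by omega),
    bondString_add_natCast_apply b i ht (by omega), bondString_add_natCast_apply b i ht (by omega),
    bondString_add_natCast_apply b i ht (by omega), hd (n + 1) (by omega) (by omega),
    hd (N - 1) (by omega) (by omega)]
  have hne : ∀ x y : PauliLabel, x ≠ y → x + y ≠ 0 := fun x y h h' =>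
    h ((PauliLabel.add_eq_zero_iff_eq x y).mp h')
  -- For `t = N - 1` the bond overhangs the left end, for `t < n` it lies within the window, for `t
  -- = n` it overhangs the right end, and for all other `t` it misses the string and commutes with
  -- it.
  rcases eq_or_ne t (N - 1) with rfl | htN
  · rw [show (N - 1 + 1) % N = 0 by rw [Nat.sub_add_cancel (by omega), Nat.mod_self]] at *
    rw [hd (N - 1) (by omega) (by omega), PauliLabel.commSign_zero_right, one_mul] at hs
    have hbd := (PauliLabel.commSign_ne_one hs).2.2
    simp only [Nat.cast_zero, add_zero] at hbd
    simp [show (0 : ℕ) ≠ N - 1 by omega, show n ≠ N - 1 by omega, show n ≠ 0 by omega,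
      show N - 1 ≠ 0 by omega, hne _ _ hbd, h1, hb]
  · rw [Nat.mod_eq_of_lt (by omega : t + 1 < N)] at *
    rcases lt_trichotomy t n with h | rfl | h
    · refine ⟨?_, ?_, Or.inl ⟨t, h, rfl⟩⟩
      · rcases eq_or_ne t 0 with rfl | h'
        · simpa using hne _ _ (by simpa using hleft)
        · simpa [h'.symm] using h0
      · rcases eq_or_ne t (n - 1) with rfl | h'
        · rw [if_neg (by omega), if_pos (by omega), zero_add]
          exact hne _ _ (by simpa using hright)
        · simpa [show n ≠ t by omega, show n ≠ t + 1 by omega] using h1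
    · rw [hd (t + 1) (by omega) (by omega), PauliLabel.commSign_zero_right, mul_one] at hs
      have hbd := (PauliLabel.commSign_ne_one hs).2.2
      simp [show (0 : ℕ) ≠ t by omega, hne _ _ hbd, h0, hb]
    · rw [hd t h ht, hd (t + 1) (by omega) (by omega), PauliLabel.commSign_zero_right,
        one_mul] at hs
      exact absurd rfl hs

/-- The commutators of the bond operators with a word: only the two that cancel an end of the
word contribute. -/
theorem IsLocalConserved.end_brackets {k : ℕ} {J h : PauliLabel → ℂ} {φ : ChainOp N →ₗ[ℂ] ℂ}
    (H : IsLocalConserved k J h φ) {n : ℕ} (hn : 2 ≤ n) (hnN : n + 3 ≤ N) (c : PauliLabel)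
    (i : ZMod N) {w : List PauliLabel} {a e : PauliLabel}
    (hb : ∀ (b : PauliLabel) (s : ZMod N), b ≠ 0 →
      PauliLabel.commSign b (wordString c i w s)
        * PauliLabel.commSign b (wordString c i w (s + 1)) ≠ 1 →
      ¬ (s = i ∧ b = a) → ¬ (s = i + ((n - 1 : ℕ) : ZMod N) ∧ b = c + e) →
      φ (pauliString (bondString b s + wordString c i w)) = 0) :
    J a * φ ⁅bondOp a i, wordOp c i w⁆
      + J (c + e) * φ ⁅bondOp (c + e) (i + ((n - 1 : ℕ) : ZMod N)), wordOp c i w⁆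
      + ∑ s : ZMod N, ∑ b : PauliLabel, h b * φ ⁅pauliAt b s, wordOp c i w⁆ = 0 := by
  rw [← H.sum_brackets (wordOp c i w)]
  congr 1
  rw [← Fintype.sum_prod_type' (fun s b => J b * φ ⁅bondOp b s, wordOp c i w⁆)]
  symm
  refine Finset.sum_eq_add (i, a) (i + ((n - 1 : ℕ) : ZMod N), c + e) ?_ ?_ (by simp) (by simp)
  · intro hc
    have h1 := (Prod.ext_iff.mp hc).1
    have h2 := natCast_ne_of_lt (N := N) (m := n - 1) (n := 0) (by omega) (by omega) (by omega)
    simp only [left_eq_add] at h1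
    exact h2 (by simpa using h1)
  · rintro ⟨s, b⟩ - ⟨h1, h2⟩
    refine mul_eq_zero_of_right _ (map_bondOp_bracket_eq_zero φ b c s i w fun h3 h4 => ?_)
    exact hb b s h3 h4 (by simpa using h1) (by simpa using h2)

end Brackets

/-! ### Strings on `k + 1` sites: defects and shift invariance. -/

section Propagation

variable {N : ℕ} [NeZero N] {k : ℕ} {J h : PauliLabel → ℂ} {φ : ChainOp N →ₗ[ℂ] ℂ}

/-- The vanishing commutator with a Pauli string on `k + 1` sites relates the two strings on `k`
sites that are obtained by removing either end. -/
theorem IsLocalConserved.shift_relation (H : IsLocalConserved k J h φ) (hk : 3 ≤ k)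
    (hkN : 2 * k ≤ N) (c : PauliLabel) (i : ZMod N) {a b l e : PauliLabel} {v x : List PauliLabel}
    (hu : a :: b :: v = x ++ [l]) (hlen : (a :: b :: v).length + 1 = k) (ha : a ≠ 0) (he : e ≠ c) :
    J a * ((1 - PauliLabel.commSign a b) * φ (wordOp c (i + 1) (b :: v ++ [e])))
      + J (c + e) * ((PauliLabel.commSign (c + e) (l + c) - 1) * φ (wordOp c i (a :: b :: v)))
      = 0 := by
  have hxlen : x.length + 2 = k := by rw [hu] at hlen; simpa using hlen
  have hvlen : v.length + 3 = k := by simpa using hlen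
  have hd0 : wordString c i (a :: b :: v ++ [e]) i = a :=
    wordString_head c i a _ (by simp; omega)
  have hdk : wordString c i (a :: b :: v ++ [e]) (i + k) = e + c := by
    have h1 := wordString_last c i (a :: b :: v) e (by omega)
    rwa [hlen] at h1
  have hdk0 : wordString c i (a :: b :: v ++ [e]) (i + k) ≠ 0 := by
    rw [hdk]; exact fun h' => he ((PauliLabel.add_eq_zero_iff_eq _ _).mp h')
  have hd : ∀ m : ℕ, k < m → m < N → wordString c i (a :: b :: v ++ [e]) (i + m) = 0 :=
    fun m hm hmN => wordString_outside c i _ (by simp; omega) hmN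
  have hends := H.end_brackets (n := k) (by omega) (by omega) c i (w := a :: b :: v ++ [e])
    (a := a) (e := e) (by
      intro b' s hb' hs h1 h2
      obtain ⟨h3, h4, -⟩ := bondString_add_ends (n := k) (by omega) (by omega)
        (by rwa [hd0]) hdk0 hd hb' hs (by rwa [hd0])
        (by rwa [hdk, add_comm e c])
      -- Both ends survive, at distance `k` one way and `N - k ≥ k` the other way around the ring.
      exact H.far _ i k le_rfl (by omega) h3 h4)
  rw [Finset.sum_eq_zero, add_zero] at hends
  · have hl := bondOp_bracket_left a b c i (v ++ [e]) (by simp; omega)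
    have hr := bondOp_bracket_right l c e i x (by omega)
    rw [show x.length + 1 = k - 1 by omega, ← hu] at hr
    rw [hr, List.cons_append, List.cons_append, hl, map_smul, map_smul, smul_eq_mul, smul_eq_mul]
      at hends
    exact hends
  · intro s _
    refine Finset.sum_eq_zero fun b' _ => mul_eq_zero_of_right _ ?_
    refine map_pauliAt_bracket_eq_zero φ b' c s i _ fun h1 h2 h3 => ?_
    -- A one-site field that anticommutes with the string only replaces a Pauli matrix by another
    -- one, so both ends survive and the product is still too wide.
    have key : ∀ j, wordString c i (a :: b :: v ++ [e]) j ≠ 0 →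
        ((Pi.single s b' : ZMod N → PauliLabel) + wordString c i (a :: b :: v ++ [e])) j ≠ 0 := by
      intro j hj
      rw [Pi.add_apply]
      by_cases hjs : j = s
      · subst hjs
        rw [Pi.single_eq_same]
        exact fun h' => h3 ((PauliLabel.add_eq_zero_iff_eq _ _).mp h')
      · rw [Pi.single_eq_of_ne hjs, zero_add]
        exact hj
    exact H.far _ i k le_rfl (by omega) (key _ (by rwa [hd0])) (key _ hdk0)

theorem PauliLabel.commSign_add_add {c e l : PauliLabel} (he : e ≠ c) (hl : l ≠ c) (hle : l ≠ e) :
    PauliLabel.commSign (c + e) (l + c) = -1 := by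
  apply PauliLabel.commSign_of_ne
  · exact fun h' => he ((PauliLabel.add_eq_zero_iff_eq _ _).mp h').symm
  · exact fun h' => hl ((PauliLabel.add_eq_zero_iff_eq _ _).mp h')
  · rw [add_comm c e]
    exact fun h' => hle (add_right_cancel h').symm

/-- The conditions on `e` make the right-hand term of `shift_relation` a nonzero multiple of the
wanted value, while `h0` removes the left-hand term. -/
theorem IsLocalConserved.eq_zero_of_shift (H : IsLocalConserved k J h φ) (hk : 3 ≤ k)
    (hkN : 2 * k ≤ N) (hJ : ∀ a, a ≠ 0 → J a ≠ 0) (c : PauliLabel) (i : ZMod N)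
    {a b l e : PauliLabel} {v x : List PauliLabel}
    (hu : a :: b :: v = x ++ [l]) (hlen : (a :: b :: v).length + 1 = k) (ha : a ≠ 0) (hl : l ≠ c)
    (he : e ≠ c) (hle : l ≠ e)
    (h0 : b = 0 ∨ b = a ∨ φ (wordOp c (i + 1) (b :: v ++ [e])) = 0) :
    φ (wordOp c i (a :: b :: v)) = 0 := by
  have h1 := H.shift_relation hk hkN c i hu hlen ha he
  have h2 : (1 - PauliLabel.commSign a b) * φ (wordOp c (i + 1) (b :: v ++ [e])) = 0 := by
    rcases h0 with rfl | rfl | h0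
    · rw [PauliLabel.commSign_zero_right, sub_self, zero_mul]
    · rw [PauliLabel.commSign_self, sub_self, zero_mul]
    · rw [h0, mul_zero]
  rw [h2, mul_zero, zero_add, PauliLabel.commSign_add_add he hl hle] at h1
  have h3 : J (c + e) ≠ 0 :=
    hJ _ fun h' => he ((PauliLabel.add_eq_zero_iff_eq _ _).mp h').symm
  rcases mul_eq_zero.mp h1 with h4 | h4
  · exact absurd h4 h3
  · rcases mul_eq_zero.mp h4 with h5 | h5
    · norm_num at h5
    · exact h5

/-- Each shift drops one letter in front of the defect `a, b`. When it reaches the left end, `a` and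
`b` commute and the left-hand term disappears. The induction is on the part `x` in front of the
defect, since the part behind it grows. -/
theorem IsLocalConserved.eq_zero_of_defect (H : IsLocalConserved k J h φ) (hk : 3 ≤ k)
    (hkN : 2 * k ≤ N) (hJ : ∀ a, a ≠ 0 → J a ≠ 0) (c : PauliLabel) (x : List PauliLabel) :
    ∀ (i : ZMod N) (a b : PauliLabel) (y : List PauliLabel), b = 0 ∨ b = a →
      (x ++ a :: b :: y).length + 1 = k → (∀ d ∈ (x ++ a :: b :: y).head?, d ≠ 0) →
      (∀ d ∈ (x ++ a :: b :: y).getLast?, d ≠ c) → φ (wordOp c i (x ++ a :: b :: y)) = 0 := by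
  induction x with
  | nil =>
    intro i a b y hab hlen hhead hlast
    rcases List.eq_nil_or_concat' (a :: b :: y) with h' | ⟨x, l, h'⟩
    · simp at h'
    · obtain ⟨e, he, hle⟩ := PauliLabel.exists_ne_ne c l
      simp only [List.nil_append] at hlen hhead hlast ⊢
      refine H.eq_zero_of_shift hk hkN hJ c i h' hlen (hhead a (by simp)) (hlast l ?_) he
        hle.symm ?_
      · rw [h']; simp
      · tauto
  | cons x₀ x ih =>
    intro i a b y hab hlen hhead hlast
    obtain ⟨b', v, hv⟩ : ∃ b' v, x ++ a :: b :: y = b' :: v :=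
      List.exists_cons_of_ne_nil (by simp)
    rw [List.cons_append, hv] at hlen hhead hlast ⊢
    rcases List.eq_nil_or_concat' (x₀ :: b' :: v) with h' | ⟨x', l, h'⟩
    · simp at h'
    · obtain ⟨e, he, hle⟩ := PauliLabel.exists_ne_ne c l
      refine H.eq_zero_of_shift hk hkN hJ c i h' hlen (hhead x₀ (by simp)) (hlast l ?_) he
        hle.symm ?_
      · rw [h']; simp
      · by_cases hb0 : b' = 0
        · exact Or.inl hb0
        refine Or.inr (Or.inr ?_)
        have hv' : b' :: v ++ [e] = x ++ a :: b :: (y ++ [e]) := by rw [← hv]; simp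
        have := ih (i + 1) a b (y ++ [e]) hab (by rw [← hv']; simpa using hlen)
          (by rw [← hv']; simpa using hb0) (by rw [← hv', List.getLast?_append]; simpa using he)
        rwa [← hv'] at this

/-- The functional vanishes on the Pauli strings on `k` sites whose total product is not the
identity. -/
theorem IsLocalConserved.eq_zero_of_total_ne_zero (H : IsLocalConserved k J h φ) (hk : 3 ≤ k)
    (hkN : 2 * k ≤ N) (hJ : ∀ a, a ≠ 0 → J a ≠ 0) {c : PauliLabel} (hc : c ≠ 0) (i : ZMod N)
    (w : List PauliLabel) (hlen : w.length + 1 = k) (hhead : ∀ d ∈ w.head?, d ≠ 0)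
    (hlast : ∀ d ∈ w.getLast?, d ≠ c) : φ (wordOp c i w) = 0 := by
  obtain ⟨a, b, v, rfl⟩ : ∃ a b v, w = a :: b :: v := by
    match w, hlen with
    | [], h' => simp at h'; omega
    | [_], h' => simp at h'; omega
    | a :: b :: v, _ => exact ⟨a, b, v, rfl⟩
  rcases List.eq_nil_or_concat' (b :: v) with h' | ⟨x, l, h'⟩
  · simp at h'
  have hl : l ≠ c := hlast l (by rw [h', ← List.cons_append, List.getLast?_concat]; rfl)
  by_cases hl0 : l = 0
  · subst hl0
    rcases List.eq_nil_or_concat' x with rfl | ⟨x', m, rfl⟩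
    · rw [h'] at hlen hhead hlast ⊢
      exact H.eq_zero_of_defect hk hkN hJ c [] i a 0 [] (Or.inl rfl) hlen hhead hlast
    · have e : a :: b :: v = (a :: x') ++ m :: 0 :: [] := by rw [h']; simp
      rw [e] at hlen hhead hlast ⊢
      exact H.eq_zero_of_defect hk hkN hJ c _ i m 0 [] (Or.inl rfl) hlen hhead hlast
  · refine H.eq_zero_of_shift hk hkN hJ c i (x := a :: x) (l := l) (e := 0) (by rw [h']; simp) hlen
      (hhead a (by simp)) hl hc.symm hl0 ?_
    by_cases hb0 : b = 0
    · exact Or.inl hb0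
    refine Or.inr (Or.inr ?_)
    have e : b :: v ++ [0] = x ++ l :: 0 :: [] := by rw [h']; simp
    rw [e]
    exact H.eq_zero_of_defect hk hkN hJ c _ (i + 1) l 0 [] (Or.inl rfl)
      (by rw [← e]; simpa using hlen) (by rw [← e]; simpa using hb0) (by simpa using hc.symm)

/-- A word without the identity label, in which neighbouring labels are different. -/
def IsDoublingWord (w : List PauliLabel) : Prop :=
  w.IsChain (· ≠ ·) ∧ ∀ a ∈ w, a ≠ 0

theorem IsLocalConserved.eq_zero_of_mem (H : IsLocalConserved k J h φ) (hk : 3 ≤ k)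
    (hkN : 2 * k ≤ N) (hJ : ∀ a, a ≠ 0 → J a ≠ 0) (i : ZMod N) (w : List PauliLabel)
    (hlen : w.length + 1 = k) (hhead : ∀ d ∈ w.head?, d ≠ 0)
    (hlast : ∀ d ∈ w.getLast?, d ≠ 0) (h0 : 0 ∈ w) : φ (wordOp 0 i w) = 0 := by
  obtain ⟨s, t, rfl⟩ := List.append_of_mem h0
  rcases List.eq_nil_or_concat' s with rfl | ⟨s, l, rfl⟩
  · simp at hhead
  · rw [List.append_assoc, List.singleton_append] at *
    exact H.eq_zero_of_defect hk hkN hJ 0 s i l 0 t (Or.inl rfl) hlen hhead hlast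

theorem IsLocalConserved.isDoublingWord (H : IsLocalConserved k J h φ) (hk : 3 ≤ k)
    (hkN : 2 * k ≤ N) (hJ : ∀ a, a ≠ 0 → J a ≠ 0) (i : ZMod N) (w : List PauliLabel)
    (hlen : w.length + 1 = k) (hhead : ∀ d ∈ w.head?, d ≠ 0)
    (hlast : ∀ d ∈ w.getLast?, d ≠ 0) (hφ : φ (wordOp 0 i w) ≠ 0) : IsDoublingWord w := by
  refine ⟨?_, fun a ha ha0 => hφ (H.eq_zero_of_mem hk hkN hJ i w hlen hhead hlast (ha0 ▸ ha))⟩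
  rw [List.isChain_iff_forall_rel_of_append_cons_cons]
  intro a b s t e hab
  subst e
  exact hφ (H.eq_zero_of_defect hk hkN hJ 0 s i a b t (Or.inr hab.symm) hlen hhead hlast)

/-- The functional on doubling words, divided by the product of the couplings, is invariant under
shifts. -/
theorem IsLocalConserved.shift_invariance (H : IsLocalConserved k J h φ) (hk : 3 ≤ k)
    (hkN : 2 * k ≤ N) (p : List PauliLabel) :
    ∀ (i : ZMod N) (x v : List PauliLabel), p.length = v.length → (p ++ x).length + 1 = k →
      IsDoublingWord (p ++ x ++ v) →
      φ (wordOp 0 (i + (p.length : ZMod N)) (x ++ v)) * (p.map J).prod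
        = φ (wordOp 0 i (p ++ x)) * (v.map J).prod := by
  induction p with
  | nil =>
    intro i x v hv _ _
    obtain rfl : v = [] := List.length_eq_zero_iff.mp hv.symm
    simp
  | cons a p ih =>
    intro i x v hv hlen hgood
    obtain ⟨e, v, rfl⟩ : ∃ e v', v = e :: v' :=
      List.exists_cons_of_ne_nil (by rintro rfl; simp at hv)
    -- One letter is exchanged per shift: `a` is dropped and `e`, the first letter of `v`, is
    -- appended.
    have hih := ih (i + 1) (x ++ [e]) v (by simpa using hv) (by simp at hlen ⊢; omega)
      ⟨by simpa using hgood.1.tail, fun b hb => hgood.2 b (by simp at hb ⊢; tauto)⟩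
    obtain ⟨b, u, hu⟩ : ∃ b u, p ++ x = b :: u :=
      List.exists_cons_of_ne_nil (by
        intro h'
        rw [List.cons_append, h'] at hlen
        simp at hlen; omega)
    rcases List.eq_nil_or_concat' (a :: b :: u) with h' | ⟨y, l, h'⟩
    · simp at h'
    have hw : a :: p ++ x ++ e :: v = a :: b :: u ++ e :: v := by rw [← hu]; simp
    rw [hw] at hgood
    have ha := hgood.2 a (by simp)
    have hb := hgood.2 b (by simp)
    have he := hgood.2 e (by simp)
    have hl := hgood.2 l (by rw [h']; simp)
    have hab : a ≠ b := by
      have := hgood.1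
      simp only [List.cons_append, List.isChain_cons_cons] at this
      exact this.1
    have hle : l ≠ e := by
      have := hgood.1
      rw [h', List.append_assoc, List.singleton_append,
        List.isChain_iff_forall_rel_of_append_cons_cons] at this
      exact this rfl
    have hrel := H.shift_relation hk hkN 0 i h' (by rw [← hu]; exact hlen) ha he
    rw [PauliLabel.commSign_of_ne ha hb hab, PauliLabel.commSign_add_add he hl hle, zero_add] at hrel
    have e1 : p ++ (x ++ [e]) = b :: u ++ [e] := by rw [← List.append_assoc, hu]
    rw [e1] at hih
    rw [List.cons_append, hu]
    simp only [List.length_cons, List.map_cons, List.prod_cons]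
    rw [List.append_assoc, List.singleton_append] at hih
    push_cast
    rw [add_comm (p.length : ZMod N) 1, ← add_assoc]
    linear_combination J a * hih + (v.map J).prod * hrel / 2

end Propagation

/-! ### Strings on `k` sites with total product along the field. -/

section Field

variable {N : ℕ} [NeZero N] {k : ℕ} {J h : PauliLabel → ℂ} {φ : ChainOp N →ₗ[ℂ] ℂ}

theorem wordString_ends {c : PauliLabel} {i : ZMod N} {w : List PauliLabel} {n : ℕ}
    (hlen : w.length = n) (hnN : n + 3 ≤ N)
    (h0 : wordString c i w i ≠ 0) (h1 : wordString c i w (i + (n : ZMod N)) ≠ 0) :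
    (∀ d ∈ w.head?, d ≠ 0) ∧ ∀ d ∈ w.getLast?, d ≠ c := by
  constructor
  · intro d hd
    obtain ⟨w, rfl⟩ := List.head?_eq_some_iff.mp hd
    rwa [wordString_head _ _ _ _ (by simp at hlen; omega)] at h0
  · intro d hd
    obtain ⟨w, rfl⟩ := List.getLast?_eq_some_iff.mp hd
    simp only [List.length_append, List.length_singleton] at hlen
    rw [← hlen, wordString_last _ _ _ _ (by omega)] at h1
    exact fun h' => h1 ((PauliLabel.add_eq_zero_iff_eq _ _).mpr h')

theorem map_pauliString_wordString (φ : ChainOp N →ₗ[ℂ] ℂ) {c : PauliLabel} {i : ZMod N}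
    {w : List PauliLabel} (h : φ (wordOp c i w) = 0) : φ (pauliString (wordString c i w)) = 0 := by
  obtain ⟨z, hz, hw⟩ := exists_wordOp_eq c i w
  rw [hw, map_smul, smul_eq_mul] at h
  exact (mul_eq_zero.mp h).resolve_left hz

theorem IsLocalConserved.eq_zero_of_sum_ne_zero (H : IsLocalConserved k J h φ) (hk : 3 ≤ k)
    (hkN : 2 * k ≤ N) (hJ : ∀ a, a ≠ 0 → J a ≠ 0) {i : ZMod N} {p : ZMod N → PauliLabel}
    (hp : ∀ m : ℕ, k - 1 < m → m < N → p (i + m) = 0) (h0 : p i ≠ 0)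
    (h1 : p (i + ((k - 1 : ℕ) : ZMod N)) ≠ 0) (hsum : ∑ j, p j ≠ 0) : φ (pauliString p) = 0 := by
  obtain ⟨c, w, hlen, rfl⟩ := exists_wordString_eq (k - 1) i p (by omega) hp
  rw [sum_wordString] at hsum
  obtain ⟨h2, h3⟩ := wordString_ends hlen (by omega) h0 h1
  exact map_pauliString_wordString φ
    (H.eq_zero_of_total_ne_zero hk hkN hJ hsum i w (by omega) h2 h3)

/-- The field matrix cancels the total product `c` and adds `c` to all partial products to its
right. The remaining sign comes from moving it through the prefix `x`. -/
theorem pauliAt_bracket_wordOp (c : PauliLabel) (i : ZMod N) (x u : List PauliLabel)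
    (hs : PauliLabel.commSign c (wordString c i (x ++ u) (i + (x.length : ZMod N))) = -1) :
    ⁅pauliAt c (i + (x.length : ZMod N)), wordOp c i (x ++ u)⁆
      = (2 * PauliLabel.commSign c (wordString 0 i x (i + (x.length : ZMod N))))
        • wordOp 0 i (x ++ u.map (c + ·)) := by
  set j := i + (x.length : ZMod N) with hj
  obtain ⟨z, -, hz⟩ := exists_wordOp_eq c i (x ++ u)
  obtain ⟨y, -, hy⟩ := exists_wordOp_eq 0 i x
  have h1 : pauliAt c j * wordOp c i (x ++ u) = -(wordOp c i (x ++ u) * pauliAt c j) := by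
    rw [hz, mul_smul_comm, pauliAt_comm_pauliString, hs, smul_mul_assoc, neg_one_smul, smul_neg]
  have h2 : pauliAt c j * wordOp c i (x ++ u)
      = PauliLabel.commSign c (wordString 0 i x j) • wordOp 0 i (x ++ u.map (c + ·)) := by
    rw [wordOp_append, wordOp_append, ← hj, ← pauliAt_mul_wordOp c j u, ← mul_assoc, hy,
      mul_smul_comm, pauliAt_comm_pauliString, smul_mul_assoc, smul_mul_assoc, smul_mul_assoc,
      mul_assoc, ← mul_assoc (pauliAt c j), pauliAt_mul_self, one_mul, smul_comm]
  rw [Ring.lie_def, mul_smul, ← h2, two_smul]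
  nth_rewrite 3 [h1]
  rw [sub_eq_add_neg]

/-- The commutators with the field along `c` of a word with labels `c`, `x` and `0` on three
consecutive bonds (or the part of this that fits on the window). -/
theorem IsLocalConserved.sum_field_brackets (H : IsLocalConserved k J h φ) (hk : 3 ≤ k)
    (hkN : 2 * k ≤ N) (hJ : ∀ a, a ≠ 0 → J a ≠ 0) {c x : PauliLabel} (hc : c ≠ 0) (hx : x ≠ 0)
    (hxc : x ≠ c) (i : ZMod N) {X Y : List PauliLabel} (hX : ∀ l ∈ X.getLast?, l = c)
    (hY : ∀ l ∈ Y.head?, l = 0) (hlen : (X ++ x :: Y).length + 1 = k)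
    (h0 : wordString c i (X ++ x :: Y) i ≠ 0)
    (h1 : wordString c i (X ++ x :: Y) (i + ((k - 1 : ℕ) : ZMod N)) ≠ 0) :
    ∑ s : ZMod N, ∑ b : PauliLabel, h b * φ ⁅pauliAt b s, wordOp c i (X ++ x :: Y)⁆
      = 2 * h c * (φ (wordOp 0 i (X ++ (x :: Y).map (c + ·)))
        - φ (wordOp 0 i (X ++ x :: Y.map (c + ·)))) := by
  have hlen' : X.length + Y.length + 2 = k := by simp at hlen; omega
  set d := wordString c i (X ++ x :: Y) with hd
  have hout : ∀ m : ℕ, k - 1 < m → m < N → d (i + (m : ZMod N)) = 0 :=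
    fun m hm hmN => wordString_outside c i _ (by omega) hmN
  have hends : ∀ (s : ZMod N) (b : PauliLabel), b ≠ d s → ∀ j, d j ≠ 0 →
      ((Pi.single s b : ZMod N → PauliLabel) + d) j ≠ 0 := by
    intro s b hb j hj
    rw [Pi.add_apply]
    by_cases hjs : j = s
    · subst hjs
      rw [Pi.single_eq_same]
      exact fun h' => hb ((PauliLabel.add_eq_zero_iff_eq _ _).mp h')
    · rw [Pi.single_eq_of_ne hjs, zero_add]
      exact hj
  rw [← Fintype.sum_prod_type' (fun s b => h b * φ ⁅pauliAt b s, wordOp c i (X ++ x :: Y)⁆)]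
  rw [Finset.sum_eq_add (i + (X.length : ZMod N), c) (i + ((X.length + 1 : ℕ) : ZMod N), c) ?_ ?_
    (by simp) (by simp)]
  · have hL : PauliLabel.commSign c (d (i + (X.length : ZMod N))) = -1 ∧
        PauliLabel.commSign c (wordString 0 i X (i + (X.length : ZMod N))) = 1 := by
      rcases List.eq_nil_or_concat' X with rfl | ⟨X', l, rfl⟩
      · simp only [List.nil_append] at hd
        simp only [List.length_nil, Nat.cast_zero, add_zero, hd]
        rw [wordString_head _ _ _ _ (by simp at hlen'; omega)]
        exact ⟨PauliLabel.commSign_of_ne hc hx hxc.symm,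
          by simp [wordString, PauliLabel.commSign_zero_right]⟩
      · obtain rfl : l = c := hX l (by simp)
        simp only [List.length_append, List.length_singleton] at hlen' ⊢
        rw [hd, wordString_append_at _ _ _ _ _ _ (by omega), wordString_last _ _ _ _ (by omega),
          add_zero]
        refine ⟨PauliLabel.commSign_of_ne hc ?_ ?_, PauliLabel.commSign_self _⟩
        · exact fun h' => hxc ((PauliLabel.add_eq_zero_iff_eq _ _).mp h').symm
        · simpa using hx
    have hR : PauliLabel.commSign c (d (i + ((X.length + 1 : ℕ) : ZMod N))) = -1 ∧
        PauliLabel.commSign c (wordString 0 i (X ++ [x]) (i + ((X.length + 1 : ℕ) : ZMod N)))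
          = -1 := by
      rw [wordString_last _ _ _ _ (by omega), add_zero]
      refine ⟨?_, PauliLabel.commSign_of_ne hc hx hxc.symm⟩
      rcases Y with _ | ⟨l, Y⟩
      · rw [hd, wordString_last _ _ _ _ (by omega)]
        refine PauliLabel.commSign_of_ne hc ?_ ?_
        · exact fun h' => hxc ((PauliLabel.add_eq_zero_iff_eq _ _).mp h')
        · simpa using hx
      · obtain rfl : l = 0 := hY l (by simp)
        have h' := wordString_append_at c i X x 0 Y (by simp at hlen'; omega)
        rw [List.append_assoc, List.singleton_append] at h'
        rw [hd, h', add_zero]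
        exact PauliLabel.commSign_of_ne hc hx hxc.symm
    have eL := pauliAt_bracket_wordOp c i X (x :: Y) (by rw [← hd]; exact hL.1)
    have eR := pauliAt_bracket_wordOp c i (X ++ [x]) Y (by
      rw [List.append_assoc, List.singleton_append, ← hd, List.length_append,
        List.length_singleton]
      exact hR.1)
    rw [List.append_assoc, List.singleton_append, List.length_append, List.length_singleton,
      hR.2, List.append_assoc, List.singleton_append] at eR
    rw [hL.2] at eL
    simp only [eL, eR, map_smul, smul_eq_mul]
    ring
  · intro hc'
    have h2 := (Prod.ext_iff.mp hc').1
    simp only [Nat.cast_add, Nat.cast_one] at h2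
    rw [← add_assoc] at h2
    exact site_ne_succ (by omega) _ h2
  · rintro ⟨s, b⟩ - ⟨h2, h3⟩
    refine mul_eq_zero_of_right _ (map_pauliAt_bracket_eq_zero φ b c s i _ fun hb hds hbd => ?_)
    obtain ⟨t, htN, rfl⟩ := exists_eq_add_natCast i s
    have ht : t < k := by
      by_contra hc'
      exact hds (hout t (by omega) htN)
    by_cases hbc : b = c
    · subst hbc
      have htX : t ≠ X.length := by
        rintro rfl; exact h2 rfl
      have htX1 : t ≠ X.length + 1 := by
        rintro rfl; exact h3 rfl
      set w := X ++ x :: Y with hw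
      have htk : (w.take t).length = t := by rw [List.length_take]; omega
      have e : (Pi.single (i + (t : ZMod N)) b : ZMod N → PauliLabel) + d
          = wordString 0 i (w.take t ++ (w.drop t).map (b + ·)) := by
        rw [hd, ← List.take_append_drop t w, wordString_append, List.take_append_drop,
          wordString_append, htk, ← single_add_wordString]
        abel
      have h4 := hends _ b hbd i h0
      have h5 := hends _ b hbd _ h1
      rw [e] at h4 h5 ⊢
      have hlen2 : (w.take t ++ (w.drop t).map (b + ·)).length = k - 1 := by
        rw [List.length_append, List.length_map, htk, List.length_drop]; omega
      obtain ⟨h6, h7⟩ := wordString_ends hlen2 (by omega) h4 h5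
      refine map_pauliString_wordString φ
        (H.eq_zero_of_mem hk hkN hJ i _ (by omega) h6 h7 ?_)
      rw [List.mem_append]
      -- A field to the left of these two sites turns the letter `c` at the end of `X` into `0`; a
      -- field to their right leaves the `0` at the start of `Y`. Either way the word is not a
      -- doubling word.
      rcases lt_or_gt_of_ne htX with h8 | h8
      · right
        rcases List.eq_nil_or_concat' X with rfl | ⟨X', l, rfl⟩
        · simp at h8
        · obtain rfl : l = b := hX l (by simp)
          simp only [List.length_append, List.length_singleton] at h8
          rw [hw, List.append_assoc, List.drop_append_of_le_length (by omega)]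
          simp
      · left
        rcases Y with _ | ⟨l, Y⟩
        · simp at hlen'; omega
        · obtain rfl : l = 0 := hY l (by simp)
          have : w = (X ++ [x, 0]) ++ Y := by simp [hw]
          rw [this, List.take_append, List.take_of_length_le (by simp; omega)]
          simp
    -- A field along another axis leaves the total product `b + c ≠ 0`.
    · refine H.eq_zero_of_sum_ne_zero hk hkN hJ (i := i) ?_ (hends _ b hbd i h0)
        (hends _ b hbd _ h1) ?_
      · intro m hm hmN
        rw [Pi.add_apply, ← hd, hout m hm hmN, single_add_natCast_apply b i htN hmN, if_neg (by omega),
          add_zero]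
      · simp only [Pi.add_apply, Finset.sum_add_distrib, sum_wordString, Finset.sum_pi_single',
          Finset.mem_univ, if_true]
        exact fun h' => hbc ((PauliLabel.add_eq_zero_iff_eq _ _).mp h')

/-- Bond terms within the window preserve the total product `c ≠ 0` and drop out, and those that
enlarge it to `k + 1` sites are too wide. What remains is the removal of either end and the two
field terms. -/
theorem IsLocalConserved.field_relation (H : IsLocalConserved k J h φ) (hk : 3 ≤ k)
    (hkN : 2 * k ≤ N) (hJ : ∀ a, a ≠ 0 → J a ≠ 0) {c x : PauliLabel} (hc : c ≠ 0) (hx : x ≠ 0)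
    (hxc : x ≠ c) (i : ZMod N) {X Y : List PauliLabel} (hX : ∀ l ∈ X.getLast?, l = c)
    (hY : ∀ l ∈ Y.head?, l = 0) (hlen : (X ++ x :: Y).length + 1 = k)
    {a b l e : PauliLabel} {v z : List PauliLabel} (hl : X ++ x :: Y = a :: b :: v)
    (hr : X ++ x :: Y = (z ++ [l]) ++ [e]) (ha : a ≠ 0) (he : e ≠ c) :
    J a * ((1 - PauliLabel.commSign a b) * φ (wordOp c (i + 1) (b :: v)))
      + J (c + e) * ((PauliLabel.commSign (c + e) (l + c) - 1) * φ (wordOp c i (z ++ [l])))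
      + 2 * h c * (φ (wordOp 0 i (X ++ (x :: Y).map (c + ·)))
        - φ (wordOp 0 i (X ++ x :: Y.map (c + ·)))) = 0 := by
  have hvlen : v.length + 3 = k := by rw [hl] at hlen; simpa using hlen
  have hzlen : z.length + 3 = k := by rw [hr] at hlen; simpa using hlen
  have hd0 : wordString c i (X ++ x :: Y) i = a := by
    rw [hl]; exact wordString_head c i a _ (by simp; omega)
  have hdk : wordString c i (X ++ x :: Y) (i + ((k - 1 : ℕ) : ZMod N)) = e + c := by
    have h1 := wordString_last c i (z ++ [l]) e (by simp; omega)
    rw [← hr] at h1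
    convert h1 using 4
    simp; omega
  have hdk0 : wordString c i (X ++ x :: Y) (i + ((k - 1 : ℕ) : ZMod N)) ≠ 0 := by
    rw [hdk]; exact fun h' => he ((PauliLabel.add_eq_zero_iff_eq _ _).mp h')
  have hd : ∀ m : ℕ, k - 1 < m → m < N → wordString c i (X ++ x :: Y) (i + m) = 0 :=
    fun m hm hmN => wordString_outside c i _ (by omega) hmN
  have hends := H.end_brackets (n := k - 1) (by omega) (by omega) c i (w := X ++ x :: Y)
    (a := a) (e := e) (by
      intro b' s hb' hs h1 h2
      obtain ⟨h3, h4, h5⟩ := bondString_add_ends (n := k - 1) (by omega) (by omega)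
        (by rwa [hd0]) hdk0 hd hb' hs (by rwa [hd0]) (by rwa [hdk, add_comm e c])
      rcases h5 with ⟨t, ht, rfl⟩ | h5 | h5
      · refine H.eq_zero_of_sum_ne_zero hk hkN hJ (i := i) ?_ h3 h4 ?_
        · intro m hm hmN
          rw [Pi.add_apply, hd m hm hmN, bondString_add_natCast_apply b' i (by omega) hmN,
            Nat.mod_eq_of_lt (by omega), if_neg (by omega), if_neg (by omega), add_zero, add_zero]
        · simpa [Finset.sum_add_distrib, sum_wordString, bondString] using hc
      · exact H.far _ i _ (by omega) (by omega) h3 h5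
      -- The string now reaches site `i - 1`, which is `N - k` steps ahead of the right end `i + (k
      -- - 1)` and `k` steps behind it.
      · refine H.far _ _ (N - k) (by omega) (by omega) h4 ?_
        rwa [add_assoc, ← Nat.cast_add, show k - 1 + (N - k) = N - 1 by omega])
  rw [H.sum_field_brackets hk hkN hJ hc hx hxc i hX hY hlen (by rwa [hd0]) hdk0] at hends
  have el := bondOp_bracket_left a b c i v (by omega)
  have er := bondOp_bracket_right l c e i z (by omega)
  rw [← hl] at el
  rw [← hr, show z.length + 1 = k - 1 - 1 by omega] at er
  rw [el, er, map_smul, map_smul, smul_eq_mul, smul_eq_mul] at hends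
  exact hends

end Field

/-! ### The sliding window and the accumulated field terms. -/

section Chain

variable {N : ℕ} [NeZero N] {k : ℕ} {J h : PauliLabel → ℂ} {φ : ChainOp N →ₗ[ℂ] ℂ}

/-- The list `0, x, 0, x, …` of length `m`. -/
def alternatingTail (x : PauliLabel) (m : ℕ) : List PauliLabel :=
  (List.range m).map fun t => if Even t then 0 else x

theorem alternatingTail_succ (x : PauliLabel) (m : ℕ) :
    alternatingTail x (m + 1) = alternatingTail x m ++ [if Even m then 0 else x] := by
  simp [alternatingTail, List.range_succ]

theorem length_alternatingTail (x : PauliLabel) (m : ℕ) : (alternatingTail x m).length = m := by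
  simp [alternatingTail]

theorem head?_alternatingTail (x : PauliLabel) (m : ℕ) : ∀ l ∈ (alternatingTail x m).head?, l = 0 := by
  cases m <;> simp [alternatingTail, List.range_succ_eq_map]

theorem mem_alternatingTail {x : PauliLabel} {m : ℕ} {l : PauliLabel}
    (hl : l ∈ alternatingTail x m) : l = 0 ∨ l = x := by
  simp only [alternatingTail, List.mem_map] at hl
  obtain ⟨t, -, rfl⟩ := hl
  split_ifs <;> simp

theorem isChain_alternatingTail {x : PauliLabel} (hx : x ≠ 0) (m : ℕ) :
    (x :: alternatingTail x m).IsChain (· ≠ ·) := by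
  rw [List.isChain_cons]
  refine ⟨fun l hl => by rw [head?_alternatingTail x m l hl]; exact hx, ?_⟩
  rw [alternatingTail, List.isChain_map, List.isChain_range]
  intro t _
  rcases Nat.even_or_odd t with ht | ht
  · have h2 : ¬ Even (t + 1) := by simpa using ht.add_one
    simp [ht, h2, hx.symm]
  · have h2 : Even (t + 1) := ht.add_one
    simp [Nat.not_even_iff_odd.mpr ht, h2, hx]

theorem cons_alternatingTail_eq (x : PauliLabel) (m : ℕ) :
    ∃ z, x :: alternatingTail x m = z ++ [if Even m then x else 0] := by
  cases m with
  | zero => exact ⟨[], by simp [alternatingTail]⟩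
  | succ m =>
    refine ⟨x :: alternatingTail x m, ?_⟩
    rw [alternatingTail_succ, List.cons_append]
    rcases Nat.even_or_odd m with hm | hm
    · have h2 : ¬ Even (m + 1) := by simpa using hm.add_one
      simp [hm, h2]
    · have h2 : Even (m + 1) := hm.add_one
      simp [Nat.not_even_iff_odd.mpr hm, h2]

/-- Adding `c` turns the tail `0, x, 0, …` into `c, c + x, c, …`, without zeros. Both `x` and `c +
x` fit between the `c` that ends `B` and the `c` that starts the new tail, so both words can be
compared with `B` by shifts. -/
theorem isDoublingWord_append_flip {c x : PauliLabel} (hx : x ≠ 0) (hxc : x ≠ c)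
    {B : List PauliLabel} (hB : IsDoublingWord B) (hBc : ∀ l ∈ B.getLast?, l = c) (hc : c ≠ 0)
    (m : ℕ) :
    IsDoublingWord (B ++ (x :: alternatingTail x m).map (c + ·)) ∧
      IsDoublingWord (B ++ x :: (alternatingTail x m).map (c + ·)) := by
  have h1 : ((x :: alternatingTail x m).map (c + ·)).IsChain (· ≠ ·) := by
    rw [List.isChain_map]
    exact (isChain_alternatingTail hx m).imp fun a b hab h' => hab (add_left_cancel h')
  have hcx : c + x ≠ 0 := fun h' => hxc ((PauliLabel.add_eq_zero_iff_eq _ _).mp h').symm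
  have h2 : ∀ a ∈ (alternatingTail x m).map (c + ·), a ≠ 0 := by
    intro a ha
    obtain ⟨l, hl, rfl⟩ := List.mem_map.mp ha
    rcases mem_alternatingTail hl with rfl | rfl
    · simpa using hc
    · exact hcx
  refine ⟨⟨List.isChain_append.mpr ⟨hB.1, h1, ?_⟩, ?_⟩,
    ⟨List.isChain_append.mpr ⟨hB.1, ?_, ?_⟩, ?_⟩⟩
  · intro a ha b hb
    rw [hBc a ha]
    simp only [List.map_cons, List.head?_cons, Option.mem_some_iff] at hb
    subst hb
    simpa using hx
  · intro a ha
    rcases List.mem_append.mp ha with ha | ha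
    · exact hB.2 a ha
    · rcases List.mem_cons.mp ha with rfl | ha
      · exact hcx
      · exact h2 a ha
  · rw [List.isChain_cons]
    refine ⟨?_, h1.tail⟩
    intro a ha
    rw [List.head?_map, Option.mem_map] at ha
    obtain ⟨l, hl, rfl⟩ := ha
    rw [head?_alternatingTail x m l hl, add_zero]
    exact hxc
  · intro a ha b hb
    rw [hBc a ha]
    simp only [List.head?_cons, Option.mem_some_iff] at hb
    subst hb
    exact hxc.symm
  · intro a ha
    rcases List.mem_append.mp ha with ha | ha
    · exact hB.2 a ha
    · rcases List.mem_cons.mp ha with rfl | ha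
      · exact hx
      · exact h2 a ha

/-- The contribution of the field along `c`, expressed by the value of the functional on a fixed
doubling word. -/
theorem IsLocalConserved.field_difference (H : IsLocalConserved k J h φ) (hk : 3 ≤ k)
    (hkN : 2 * k ≤ N) {c x : PauliLabel} (hc : c ≠ 0)
    (hx : x ≠ 0) (hxc : x ≠ c) (i : ZMod N) {B : List PauliLabel} (hB : IsDoublingWord B)
    (hlen : B.length + 1 = k) (hBc : ∀ l ∈ B.getLast?, l = c) {p X : List PauliLabel}
    (hpX : B = p ++ X) {m : ℕ} (hm : p.length = m + 1) :
    (φ (wordOp 0 (i + (p.length : ZMod N)) (X ++ (x :: alternatingTail x m).map (c + ·)))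
      - φ (wordOp 0 (i + (p.length : ZMod N)) (X ++ x :: (alternatingTail x m).map (c + ·))))
        * (B.map J).prod
      = φ (wordOp 0 i B) * (J (c + x) - J x) * (X.map J).prod
        * (((alternatingTail x m).map (c + ·)).map J).prod := by
  obtain ⟨h1, h2⟩ := isDoublingWord_append_flip hx hxc hB hBc hc m
  rw [hpX] at h1 h2
  have e1 := H.shift_invariance hk hkN p i X ((x :: alternatingTail x m).map (c + ·))
    (by simp [length_alternatingTail, hm]) (by rw [← hpX]; exact hlen) h1
  have e2 := H.shift_invariance hk hkN p i X (x :: (alternatingTail x m).map (c + ·))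
    (by simp [length_alternatingTail, hm]) (by rw [← hpX]; exact hlen) h2
  rw [← hpX] at e1 e2
  have e3 : (B.map J).prod = (p.map J).prod * (X.map J).prod := by rw [hpX]; simp
  simp only [List.map_cons, List.prod_cons] at e1 e2 ⊢
  rw [e3]
  linear_combination (X.map J).prod * (e1 - e2)

theorem getLast?_of_append {B p X : List PauliLabel} {c : PauliLabel} (hpX : B = p ++ X)
    (hBc : ∀ l ∈ B.getLast?, l = c) : ∀ l ∈ X.getLast?, l = c := by
  intro l hl
  obtain ⟨X', rfl⟩ := List.getLast?_eq_some_iff.mp hl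
  exact hBc l (by rw [hpX, ← List.append_assoc]; simp)

theorem prod_map_ne_zero {J : PauliLabel → ℂ} (hJ : ∀ a, a ≠ 0 → J a ≠ 0) {w : List PauliLabel}
    (hw : ∀ a ∈ w, a ≠ 0) : (w.map J).prod ≠ 0 := by
  refine List.prod_ne_zero fun hmem => ?_
  obtain ⟨a, ha, ha0⟩ := List.mem_map.mp hmem
  exact hJ a (hw a ha) ha0

/-- The relations from the field along `c` for the windows that slide along the word
`B ++ [x, 0, x, 0, …]`, summed up to the window that starts with the remainder `X` of `B`. -/
theorem IsLocalConserved.chain_relation (H : IsLocalConserved k J h φ) (hk : 3 ≤ k)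
    (hkN : 2 * k ≤ N) (hJ : ∀ a, a ≠ 0 → J a ≠ 0) {c x : PauliLabel} (hc : c ≠ 0)
    (hx : x ≠ 0) (hxc : x ≠ c) (i : ZMod N) {B : List PauliLabel} (hB : IsDoublingWord B)
    (hlen : B.length + 1 = k) (hBc : ∀ l ∈ B.getLast?, l = c) (m : ℕ) :
    ∀ (p X : List PauliLabel) (a b : PauliLabel) (v : List PauliLabel), B = p ++ X →
      p.length = m + 1 → X ++ x :: alternatingTail x m = a :: b :: v →
      (J a * ((1 - PauliLabel.commSign a b)
          * φ (wordOp c (i + (p.length : ZMod N) + 1) (b :: v)))) * (B.map J).prod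
        + 2 * (m + 1) * (h c * φ (wordOp 0 i B) * (J (c + x) - J x) * (X.map J).prod
          * (((alternatingTail x m).map (c + ·)).map J).prod) = 0 := by
  induction m with
  | zero =>
    intro p X a b v hpX hm hv
    have hXc := getLast?_of_append hpX hBc
    have hXlen : X.length + 2 = k := by rw [hpX] at hlen; simp [hm] at hlen; omega
    have ha : a ≠ 0 := by
      rcases X with _ | ⟨d, X⟩
      · simp at hXlen; omega
      · simp only [List.cons_append, List.cons.injEq] at hv
        rw [← hv.1]
        exact hB.2 d (by rw [hpX]; simp)
    rcases List.eq_nil_or_concat' X with hX0 | ⟨z, l, hz⟩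
    · rw [hX0] at hXlen; simp at hXlen; omega
    obtain rfl : l = c := hXc l (by rw [hz]; simp)
    have hrel := H.field_relation hk hkN hJ hc hx hxc (i + (p.length : ZMod N)) hXc
      (head?_alternatingTail x 0) (by simp [length_alternatingTail]; omega) hv
      (l := l) (z := z) (e := x) (by rw [hz]; simp [alternatingTail]) ha hxc
    have hdiff := H.field_difference hk hkN hc hx hxc i hB hlen hBc hpX hm
    -- In the first window the letter before `x` is `c`, so the shortened word ends in the identity
    -- and the right end gives no contribution.
    rw [PauliLabel.add_self, PauliLabel.commSign_zero_right, sub_self, zero_mul, mul_zero,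
      add_zero] at hrel
    push_cast
    linear_combination (B.map J).prod * hrel - 2 * h l * hdiff
  | succ m ih =>
    intro p X a b v hpX hm hv
    have hXc := getLast?_of_append hpX hBc
    have hXlen : X.length + m + 3 = k := by rw [hpX] at hlen; simp [hm] at hlen; omega
    have ha : a ≠ 0 := by
      rcases X with _ | ⟨d, X⟩
      · simp only [List.nil_append, List.cons.injEq] at hv
        rw [← hv.1]
        exact hx
      · simp only [List.cons_append, List.cons.injEq] at hv
        rw [← hv.1]
        exact hB.2 d (by rw [hpX]; simp)
    obtain ⟨p, d, rfl⟩ : ∃ q d, p = q ++ [d] := by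
      rcases List.eq_nil_or_concat' p with hp | hp
      · rw [hp] at hm; simp at hm
      · exact hp
    have hpm : p.length = m + 1 := by simpa using hm
    have hpX' : B = p ++ d :: X := by rw [hpX]; simp
    have hd : d ≠ 0 := hB.2 d (by rw [hpX']; simp)
    obtain ⟨b', v', hv'⟩ : ∃ b' v', X ++ x :: alternatingTail x m = b' :: v' :=
      List.exists_cons_of_ne_nil (by simp)
    have hdb : d ≠ b' ∧ b' ≠ 0 := by
      rcases X with _ | ⟨l, X⟩
      · obtain rfl : d = c := hBc d (by rw [hpX']; simp)
        simp only [List.nil_append, List.cons.injEq] at hv'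
        rw [← hv'.1]
        exact ⟨hxc.symm, hx⟩
      · simp only [List.cons_append, List.cons.injEq] at hv'
        rw [← hv'.1]
        refine ⟨?_, hB.2 l (by rw [hpX']; simp)⟩
        have := hB.1
        rw [hpX', List.isChain_iff_forall_rel_of_append_cons_cons] at this
        exact this rfl
    have hih := ih p (d :: X) d b' v' hpX' hpm (by rw [List.cons_append, hv'])
    rw [PauliLabel.commSign_of_ne hd hdb.2 hdb.1, ← hv'] at hih
    obtain ⟨z, hz⟩ := cons_alternatingTail_eq x m
    set l : PauliLabel := if Even m then x else 0 with hl
    set e : PauliLabel := if Even m then 0 else x with he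
    have hle : l ≠ e ∧ e ≠ c ∧ l ≠ c := by
      rw [hl, he]
      split_ifs
      · exact ⟨hx, hc.symm, hxc⟩
      · exact ⟨hx.symm, hxc, hc.symm⟩
    have hsite : i + (p.length : ZMod N) + 1 = i + ((p ++ [d]).length : ZMod N) := by
      simp [add_assoc]
    have hword : X ++ z ++ [l] = X ++ x :: alternatingTail x m := by rw [hz, List.append_assoc]
    have hrel := H.field_relation hk hkN hJ hc hx hxc (i + ((p ++ [d]).length : ZMod N)) hXc
      (head?_alternatingTail x (m + 1)) (by simp [length_alternatingTail]; omega) hv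
      (l := l) (z := X ++ z) (e := e)
      (by rw [hword, alternatingTail_succ, List.append_assoc, List.cons_append]) ha hle.2.1
    have hdiff := H.field_difference hk hkN hc hx hxc i hB hlen hBc hpX hm
    rw [PauliLabel.commSign_add_add hle.2.1 hle.2.2 hle.1, hword] at hrel
    rw [hsite] at hih
    have hprod : (((alternatingTail x (m + 1)).map (c + ·)).map J).prod
        = (((alternatingTail x m).map (c + ·)).map J).prod * J (c + e) := by
      rw [alternatingTail_succ]; simp [he]
    rw [hprod] at hdiff ⊢
    simp only [List.map_cons, List.prod_cons] at hih
    have hcancel : J d * (φ (wordOp c (i + ((p ++ [d]).length : ZMod N))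
          (X ++ x :: alternatingTail x m)) * (B.map J).prod
        + (m + 1) * (h c * φ (wordOp 0 i B) * (J (c + x) - J x) * (X.map J).prod
          * (((alternatingTail x m).map (c + ·)).map J).prod)) = 0 := by
      linear_combination hih / 2
    have hS := (mul_eq_zero.mp hcancel).resolve_left (hJ d hd)
    push_cast
    linear_combination (B.map J).prod * hrel - 2 * h c * hdiff + 2 * J (c + e) * hS

theorem IsLocalConserved.eq_zero_of_doublingWord_last (H : IsLocalConserved k J h φ) (hk : 3 ≤ k)
    (hkN : 2 * k ≤ N) (hJ : ∀ a, a ≠ 0 → J a ≠ 0) {c x : PauliLabel} (hc : c ≠ 0)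
    (hx : x ≠ 0) (hxc : x ≠ c) (hJx : J x ≠ J (c + x)) (hh : h c ≠ 0) (i : ZMod N)
    {B : List PauliLabel} (hB : IsDoublingWord B)
    (hlen : B.length + 1 = k) (hBc : ∀ l ∈ B.getLast?, l = c) : φ (wordOp 0 i B) = 0 := by
  -- In the last window all of `B` has been dropped. The window starts with `x, 0`, which commute,
  -- so only the `k - 1 = m + 2` equal field terms are left.
  obtain ⟨m, rfl⟩ : ∃ m, k = m + 3 := ⟨k - 3, by omega⟩
  have htail : alternatingTail x (m + 1) = 0 :: (alternatingTail x (m + 1)).tail := by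
    simp [alternatingTail, List.range_succ_eq_map]
  have h1 := H.chain_relation hk hkN hJ hc hx hxc i hB hlen hBc (m + 1) B [] x 0
    (alternatingTail x (m + 1)).tail (by simp) (by omega) (by rw [← htail]; rfl)
  rw [PauliLabel.commSign_zero_right, sub_self, zero_mul, mul_zero, zero_mul, zero_add] at h1
  have h2 : (((alternatingTail x (m + 1)).map (c + ·)).map J).prod ≠ 0 := by
    refine prod_map_ne_zero hJ fun a ha => ?_
    exact (isDoublingWord_append_flip hx hxc hB hBc hc (m + 1)).2.2 a (by simp at ha ⊢; tauto)
  have h3 : J (c + x) - J x ≠ 0 := sub_ne_zero.mpr hJx.symm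
  have h4 : ((m + 1 : ℕ) : ℂ) + 1 ≠ 0 := Nat.cast_add_one_ne_zero _
  by_contra hφ
  refine mul_ne_zero (mul_ne_zero two_ne_zero h4)
    (mul_ne_zero (mul_ne_zero (mul_ne_zero (mul_ne_zero hh hφ) h3) ?_) h2) h1
  simp

/-- A field along `c` forbids conserved quantities if the couplings of the two other directions
differ. -/
theorem IsLocalConserved.eq_zero_of_doublingWord (H : IsLocalConserved k J h φ) (hk : 3 ≤ k)
    (hkN : 2 * k ≤ N) (hJ : ∀ a, a ≠ 0 → J a ≠ 0) {c x : PauliLabel} (hc : c ≠ 0)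
    (hx : x ≠ 0) (hxc : x ≠ c) (hJx : J x ≠ J (c + x)) (hh : h c ≠ 0) (i : ZMod N)
    {w : List PauliLabel} (hw : IsDoublingWord w) (hlen : w.length + 1 = k) :
    φ (wordOp 0 i w) = 0 := by
  rcases w with _ | ⟨a, w⟩
  · simp at hlen; omega
  rcases List.eq_nil_or_concat' (a :: w) with h' | ⟨z, l, hz⟩
  · simp at h'
  by_cases hl : l = c
  · refine H.eq_zero_of_doublingWord_last hk hkN hJ hc hx hxc hJx hh i hw hlen ?_
    rw [hz]; simp [hl]
  -- Since the last letter is not `c`, one shift may append `c`, which reduces to the previous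
  -- lemma.
  · have hgood : IsDoublingWord (a :: w ++ [c]) := by
      refine ⟨List.isChain_append.mpr ⟨hw.1, by simp, ?_⟩, ?_⟩
      · rw [hz]; simpa using hl
      · intro b hb
        rcases List.mem_append.mp hb with hb | hb
        · exact hw.2 b hb
        · rw [List.mem_singleton.mp hb]; exact hc
    have h1 := H.shift_invariance hk hkN [a] i w [c] rfl hlen (by simpa using hgood)
    rw [H.eq_zero_of_doublingWord_last hk hkN hJ hc hx hxc hJx hh _ (B := w ++ [c])
      ⟨by simpa using hgood.1.tail, fun b hb => hgood.2 b (by simp at hb ⊢; tauto)⟩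
      (by simpa using hlen) (by simp), zero_mul] at h1
    simpa [hJ c hc] using h1.symm

end Chain

/-! ### From conserved quantities to functionals, and the classification. -/

section Main

variable {N : ℕ} [NeZero N]

/-- The couplings of the standard Hamiltonian, or its fields, by Pauli labels. -/
def labelCoeff (rX rY rZ : ℝ) (a : PauliLabel) : ℂ :=
  if a = (1, 0) then rX else if a = (1, 1) then rY else if a = (0, 1) then rZ else 0

theorem standardHamiltonian_eq (JX JY JZ hX hY hZ : ℝ) :
    standardHamiltonian N JX JY JZ hX hY hZ
      = pauliHamiltonian N (labelCoeff JX JY JZ) (labelCoeff hX hY hZ) := by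
  have hu : (Finset.univ : Finset PauliLabel) = {(0, 0), (1, 0), (1, 1), (0, 1)} := by decide
  have hx (i : ZMod N) : siteOp pauliX i = pauliAt (1, 0) i := by
    rw [pauliAt, ← siteOp_mat]; rfl
  have hy (i : ZMod N) : siteOp pauliY i = pauliAt (1, 1) i := by
    rw [pauliAt, ← siteOp_mat]; rfl
  have hz (i : ZMod N) : siteOp pauliZ i = pauliAt (0, 1) i := by
    rw [pauliAt, ← siteOp_mat]; rfl
  rw [standardHamiltonian, pauliHamiltonian]
  refine Finset.sum_congr rfl fun i _ => ?_
  rw [hu]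
  simp only [hx, hy, hz]
  rw [Finset.sum_insert (by decide), Finset.sum_insert (by decide), Finset.sum_insert (by decide),
    Finset.sum_singleton]
  simp [labelCoeff, bondOp]
  abel

theorem mem_siteWindow {i j : ZMod N} {l : ℕ} :
    j ∈ siteWindow i l ↔ ∃ m < l, j = i + (m : ZMod N) := by
  simp [siteWindow, eq_comm]

theorem siteWindow_mono (i : ZMod N) {l k : ℕ} (h : l ≤ k) : siteWindow i l ⊆ siteWindow i k := by
  intro j hj
  obtain ⟨m, hm, rfl⟩ := mem_siteWindow.mp hj
  exact mem_siteWindow.mpr ⟨m, by omega, rfl⟩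

/-- The pairing of operators with `Q` by the trace. -/
def tracePairing (Q : ChainOp N) : ChainOp N →ₗ[ℂ] ℂ :=
  (Matrix.traceLinearMap (SpinConfig N) ℂ ℂ).comp (LinearMap.mulLeft ℂ Q)

theorem tracePairing_apply (Q A : ChainOp N) : tracePairing Q A = (Q * A).trace := rfl

theorem exists_window_of_tracePairing_ne_zero {k : ℕ} {Q : ChainOp N}
    (hQ : Q ∈ Submodule.span ℂ {A : ChainOp N | ∃ l, l ≤ k ∧ IsSupportOperator l A})
    {p : ZMod N → PauliLabel} (hp : tracePairing Q (pauliString p) ≠ 0) :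
    ∃ i, ∀ j, j ∉ siteWindow i k → p j = 0 := by
  by_contra! hc
  apply hp
  rw [tracePairing_apply]
  induction hQ using Submodule.span_induction with
  | mem A hA =>
    obtain ⟨l, hl, i, hi⟩ := hA
    obtain ⟨j, hj, hpj⟩ := hc i
    exact hi.trace_mul_pauliString (fun h => hj (siteWindow_mono i hl h)) hpj
  | zero => simp
  | add A B _ _ hA hB =>
    rw [add_mul, Matrix.trace_add]
    by_cases h : tracePairing A (pauliString p) = 0 <;>
      by_cases h' : tracePairing B (pauliString p) = 0 <;>
      simp_all [tracePairing_apply]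
  | smul z A _ hA =>
    rw [smul_mul_assoc, Matrix.trace_smul]
    by_cases h : tracePairing A (pauliString p) = 0 <;> simp_all [tracePairing_apply]

/-- The trace pairings are, up to the factor `2 ^ N`, the coefficients of `Q` in the basis of Pauli
strings. -/
theorem mem_span_of_tracePairing {k : ℕ} {Q : ChainOp N}
    (hQ : ∀ p : ZMod N → PauliLabel, tracePairing Q (pauliString p) ≠ 0 →
      ∃ l < k, ∃ i, ∀ j, j ∉ siteWindow i l → p j = 0) :
    Q ∈ Submodule.span ℂ {A : ChainOp N | ∃ l, l < k ∧ IsSupportOperator l A} := by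
  have h2 : (2 : ℂ) ^ N ≠ 0 := pow_ne_zero _ two_ne_zero
  rw [← inv_smul_smul₀ h2 Q, ← sum_trace_smul_pauliString]
  refine Submodule.smul_mem _ _ (Submodule.sum_mem _ fun p _ => ?_)
  by_cases hp : tracePairing Q (pauliString p) = 0
  · rw [tracePairing_apply] at hp
    rw [hp, zero_smul]
    exact Submodule.zero_mem _
  · obtain ⟨l, hl, i, hi⟩ := hQ p hp
    exact Submodule.smul_mem _ _ (Submodule.subset_span ⟨l, hl, i, actsOn_pauliString hi⟩)

theorem isLocalConserved_tracePairing {k : ℕ} {J h : PauliLabel → ℂ} {Q : ChainOp N}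
    (hcomm : Commute Q (pauliHamiltonian N J h))
    (hQ : Q ∈ Submodule.span ℂ {A : ChainOp N | ∃ l, l ≤ k ∧ IsSupportOperator l A}) :
    IsLocalConserved k J h (tracePairing Q) := by
  constructor
  · intro D
    rw [tracePairing_apply, Ring.lie_def, mul_sub, Matrix.trace_sub, ← mul_assoc, hcomm.eq,
      mul_assoc, Matrix.trace_mul_comm, ← mul_assoc, sub_self]
  · intro p i m hm hmN h0 h1
    by_contra hp
    obtain ⟨s, hs⟩ := exists_window_of_tracePairing_ne_zero hQ hp
    have h2 : i ∈ siteWindow s k := by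
      by_contra hc; exact h0 (hs i hc)
    have h3 : i + (m : ZMod N) ∈ siteWindow s k := by
      by_contra hc; exact h1 (hs _ hc)
    obtain ⟨x, hx, rfl⟩ := mem_siteWindow.mp h2
    obtain ⟨y, hy, hxy⟩ := mem_siteWindow.mp h3
    rw [add_assoc, add_right_inj, ← Nat.cast_add] at hxy
    -- Since `x, y < k` and `k ≤ m ≤ N - k`, one has `y < x + m < N`, so the two offsets are
    -- different sites.
    exact natCast_ne_of_lt (N := N) (m := x + m) (n := y) (by omega) (by omega) (by omega) hxy

/-- If the field along the axis `c` does not vanish, and the couplings along the two other axes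
differ, there is no `k`-support conserved quantity. -/
theorem not_exists_conserved {k : ℕ} (hk : 3 ≤ k) (hkN : 2 * k ≤ N) {J h : PauliLabel → ℂ}
    (hJ : ∀ a, a ≠ 0 → J a ≠ 0) {c x : PauliLabel} (hc : c ≠ 0) (hx : x ≠ 0) (hxc : x ≠ c)
    (hJx : J x ≠ J (c + x)) (hh : h c ≠ 0) :
    ¬ ∃ Q : ChainOp N, IsSupportConservedQuantity (pauliHamiltonian N J h) k Q := by
  rintro ⟨Q, hcomm, hQ, hQ'⟩
  have H := isLocalConserved_tracePairing hcomm hQ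
  apply hQ'
  refine mem_span_of_tracePairing fun p hp => ?_
  by_contra! hsmall
  obtain ⟨i, hi⟩ := exists_window_of_tracePairing_ne_zero hQ hp
  have hout : ∀ m : ℕ, k - 1 < m → m < N → p (i + m) = 0 := by
    intro m hm hmN
    refine hi _ fun hmem => ?_
    obtain ⟨y, hy, hy'⟩ := mem_siteWindow.mp hmem
    rw [add_right_inj] at hy'
    exact natCast_ne_of_lt hmN (by omega) (by omega) hy'
  -- If an end of the window carried the identity, the string would fit on the `k - 1` remaining
  -- sites, against `hsmall`.
  have h0 : p i ≠ 0 := by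
    intro h0
    obtain ⟨j, hj, hpj⟩ := hsmall (k - 1) (by omega) (i + 1)
    have hjk : j ∈ siteWindow i k := by
      by_contra hc'; exact hpj (hi j hc')
    obtain ⟨y, hy, rfl⟩ := mem_siteWindow.mp hjk
    rcases Nat.eq_zero_or_pos y with rfl | hy0
    · simp [h0] at hpj
    · refine hj (mem_siteWindow.mpr ⟨y - 1, by omega, ?_⟩)
      rw [Nat.cast_sub (by omega)]; push_cast; ring
  have h1 : p (i + ((k - 1 : ℕ) : ZMod N)) ≠ 0 := by
    intro h1
    obtain ⟨j, hj, hpj⟩ := hsmall (k - 1) (by omega) i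
    have hjk : j ∈ siteWindow i k := by
      by_contra hc'; exact hpj (hi j hc')
    obtain ⟨y, hy, rfl⟩ := mem_siteWindow.mp hjk
    rcases eq_or_ne y (k - 1) with rfl | hyk
    · exact hpj h1
    · exact hj (mem_siteWindow.mpr ⟨y, by omega, rfl⟩)
  obtain ⟨d, w, hlen, rfl⟩ := exists_wordString_eq (k - 1) i p (by omega) hout
  obtain ⟨h2, h3⟩ := wordString_ends hlen (by omega) h0 h1
  apply hp
  refine map_pauliString_wordString _ ?_
  by_cases hd : d = 0
  · subst hd
    by_contra hφ
    exact hφ (H.eq_zero_of_doublingWord hk hkN hJ hc hx hxc hJx hh i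
      (H.isDoublingWord hk hkN hJ i w (by omega) h2 h3 hφ) (by omega))
  · exact H.eq_zero_of_total_ne_zero hk hkN hJ hd i w (by omega) h2 h3

end Main

theorem lemma2 (N : ℕ) [NeZero N] (k : ℕ) (hk : 3 ≤ k) (hkN : 2 * k ≤ N)
    (JX JY JZ hX hY hZ : ℝ) (hJX : JX ≠ 0) (hJY : JY ≠ 0) (hJZ : JZ ≠ 0) :
    (JX ≠ JY → hZ ≠ 0 →
      ¬ ∃ Q : ChainOp N,
        IsSupportConservedQuantity (standardHamiltonian N JX JY JZ hX hY hZ) k Q) ∧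
    (¬ (JX = JY ∧ JY = JZ) →
      ¬ (JX = JY ∧ hX = 0 ∧ hY = 0) →
      ¬ (JY = JZ ∧ hY = 0 ∧ hZ = 0) →
      ¬ (JZ = JX ∧ hZ = 0 ∧ hX = 0) →
      ¬ (hX = 0 ∧ hY = 0 ∧ hZ = 0) →
      ¬ ∃ Q : ChainOp N,
        IsSupportConservedQuantity (standardHamiltonian N JX JY JZ hX hY hZ) k Q) := by
  rw [standardHamiltonian_eq]
  have hJ : ∀ a : PauliLabel, a ≠ 0 → labelCoeff JX JY JZ a ≠ 0 := by
    intro a ha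
    rcases PauliLabel.cases_label a with rfl | rfl | rfl | rfl
    · exact absurd rfl ha
    all_goals simpa [labelCoeff]
  have h2 : (1 : ZMod 2) + 1 = 0 := by decide
  -- With `c` the label of the field axis and `x` that of one of the other two axes, `c + x` is the
  -- label of the third.
  have fieldZ : JX ≠ JY → hZ ≠ 0 → ¬ ∃ Q : ChainOp N, IsSupportConservedQuantity
      (pauliHamiltonian N (labelCoeff JX JY JZ) (labelCoeff hX hY hZ)) k Q := fun h1 h3 =>
    not_exists_conserved hk hkN hJ (c := (0, 1)) (x := (1, 0)) (by decide) (by decide) (by decide)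
      (by simpa [labelCoeff] using h1) (by simpa [labelCoeff] using h3)
  have fieldX : JY ≠ JZ → hX ≠ 0 → ¬ ∃ Q : ChainOp N, IsSupportConservedQuantity
      (pauliHamiltonian N (labelCoeff JX JY JZ) (labelCoeff hX hY hZ)) k Q := fun h1 h3 =>
    not_exists_conserved hk hkN hJ (c := (1, 0)) (x := (1, 1)) (by decide) (by decide) (by decide)
      (by simpa [labelCoeff, h2] using h1) (by simpa [labelCoeff] using h3)
  have fieldY : JZ ≠ JX → hY ≠ 0 → ¬ ∃ Q : ChainOp N, IsSupportConservedQuantity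
      (pauliHamiltonian N (labelCoeff JX JY JZ) (labelCoeff hX hY hZ)) k Q := fun h1 h3 =>
    not_exists_conserved hk hkN hJ (c := (1, 1)) (x := (0, 1)) (by decide) (by decide) (by decide)
      (by simpa [labelCoeff, h2] using h1) (by simpa [labelCoeff] using h3)
  refine ⟨fieldZ, fun n1 n2 n3 n4 n5 => ?_⟩
  by_cases hz : JX ≠ JY ∧ hZ ≠ 0
  · exact fieldZ hz.1 hz.2
  by_cases hx : JY ≠ JZ ∧ hX ≠ 0
  · exact fieldX hx.1 hx.2
  by_cases hy : JZ ≠ JX ∧ hY ≠ 0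
  · exact fieldY hy.1 hy.2
  exfalso
  -- Now each axis has a vanishing field or equal couplings on the two other axes. No nonzero field
  -- gives XYZ without field, exactly one gives XXZ with a field along its axis, and two or more
  -- force all couplings to be equal.
  grind
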